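/- **Theorem 1.8.** Let $G=(V,E)$ be a directed graph on $V=\{0,\dots,n-1\}$ with positive real edge capacities $w(e)$ ($e\in E\subseteq V\times V$), a source $s$ and a sink $t\neq s$. An $(s,t)$-cut is a set $C\subseteq V$ with $s\in C$, $t\notin C$; an edge $(u,v)$ contributes to $C$ if $u\in C$, $v\notin C$; the capacity $c(C)$ is the sum of the capacities of the contributing edges, and $f^*$ is the least capacity of an $(s,t)$-cut (the $(s,t)$-mincut capacity). An edge is *vital* if its removal decreases the $(s,t)$-mincut capacity. A *mincut for an edge* $e$ is an $(s,t)$-cut of least capacity among those to which $e$ contributes. Let $\mathcal T_{vit}(G)$ be any rooted full binary tree obtained by the following recursive construction, started with $U=V$. If no vital edge has both endpoints in $U$, create a leaf and map all vertices of $U$ to it. Otherwise, select a vital edge $e$ with both endpoints in $U$ for which the capacity of a mincut is least among all vital edges with both endpoints in $U$, choose a mincut $C$ for $e$, create an internal node that stores $c(C)$, and construct its left subtree from $U\cap C$ and its right subtree from $U\setminus C$. Such a tree exists. Every such tree has at most $2n-1$ nodes and satisfies the following, where $\nu$ denotes the lowest common ancestor (LCA) of the leaves to which $u$ and $v$ are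 mapped. 1. For every vital edge $(u,v)$, $\nu$ is an internal node and the capacity stored at $\nu$ is the capacity of a mincut for $(u,v)$. 2. An edge $e=(u,v)\in E$ is vital if and only if $\nu$ is an internal node, $u$ belongs to its left subtree, $v$ belongs to its right subtree, and $f'-w(e)<f^*$, where $f'$ is the capacity stored at $\nu$. 3. There is a data structure for $G$ and the tree that occupies $O(n)$ memory cells, each holding either one word of $O(\log n)$ bits or one real number, and that answers the following queries in $O(1)$ time: - given $u,v\in V$, report whether $u$ and $v$ are mapped to the same leaf and, if not, report in which of the two subtrees of $\nu$ each of them lies, and the capacity stored at $\nu$; - given an edge $e=(u,v)\in E$ (by its endpoints) and a real $\Delta\ge -w(e)$, report the $(s,t)$-mincut capacity of the graph obtained from $G$ by changing the capacity of $e$ from $w(e)$ to $w(e)+\Delta$. The machine is a word RAM with words of $\Theta(\log n)$ bits and the operations $+,-,\times,\div,\bmod$, bitwise and/or/xor, shifts and comparisons on words, and with separate cells and registers for real numbers, which can only be loaded, added, subtracted and compared. Each of the two queries is answered by one fixed program, and these programs and the constants in all $O(\cdot)$ and $\Theta(\cdot)$ are absolute: they do not depend on $n$, $G$, the tree or the query.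 -/

import Mathlib

/-! ### Directed weighted graphs, cuts, vital edges -/

/-- A directed graph on the vertex set `V` with real edge capacities, a source and a sink. -/
structure STGraph (V : Type*) where
  /-- the edge set -/
  edges : Finset (V × V)
  /-- the capacity `w e` of an edge; its values off `edges` are never used -/
  cap : V × V → ℝ
  source : V
  sink : V
  source_ne_sink : source ≠ sink

namespace STGraph

variable {V : Type*} [Fintype V] [DecidableEq V]

/-- `C` is an `(s,t)`-cut: it contains the source and not the sink. -/
def IsCut (G : STGraph V) (C : Finset V) : Prop :=
  G.source ∈ C ∧ G.sink ∉ C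

instance (G : STGraph V) : DecidablePred G.IsCut :=
  fun _ => inferInstanceAs (Decidable (_ ∧ _))

/-- The finite set of all `(s,t)`-cuts. -/
def cuts (G : STGraph V) : Finset (Finset V) :=
  Finset.univ.filter G.IsCut

theorem cuts_nonempty (G : STGraph V) : G.cuts.Nonempty :=
  ⟨{G.source}, by simp [cuts, IsCut, G.source_ne_sink.symm]⟩

/-- The edge `e` contributes to `C`: it leaves `C`. -/
def Contributes (G : STGraph V) (e : V × V) (C : Finset V) : Prop :=
  e ∈ G.edges ∧ e.1 ∈ C ∧ e.2 ∉ C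

instance (G : STGraph V) (e : V × V) (C : Finset V) : Decidable (G.Contributes e C) :=
  inferInstanceAs (Decidable (_ ∧ _))

/-- The capacity of `C`: the sum of the capacities of its contributing edges. -/
def cutCapacity (G : STGraph V) (C : Finset V) : ℝ :=
  ∑ e ∈ G.edges.filter (fun e => G.Contributes e C), G.cap e

/-- The capacity `f*` of an `(s,t)`-mincut. -/
noncomputable def minCutCapacity (G : STGraph V) : ℝ :=
  G.cuts.inf' G.cuts_nonempty G.cutCapacity

/-- The graph after the removal of the edge `e`. -/
def removeEdge (G : STGraph V) (e : V × V) : STGraph V :=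
  { G with edges := G.edges.erase e }

/-- The graph in which the capacity of `e` has been changed to `x`. -/
def setCapacity (G : STGraph V) (e : V × V) (x : ℝ) : STGraph V :=
  { G with cap := Function.update G.cap e x }

/-- An edge is vital if its removal decreases the capacity of the `(s,t)`-mincut. -/
def IsVital (G : STGraph V) (e : V × V) : Prop :=
  e ∈ G.edges ∧ (G.removeEdge e).minCutCapacity < G.minCutCapacity

/-- `C` is a mincut for the edge `e`: an `(s,t)`-cut of least capacity among those to which `e`
contributes. -/
def IsMinCutFor (G : STGraph V) (C : Finset V) (e : V × V) : Prop :=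
  G.IsCut C ∧ G.Contributes e C ∧
    ∀ C', G.IsCut C' → G.Contributes e C' → G.cutCapacity C ≤ G.cutCapacity C'

/-- `e` is a vital edge with both endpoints in `U`. -/
def IsVitalIn (G : STGraph V) (U : Finset V) (e : V × V) : Prop :=
  G.IsVital e ∧ e.1 ∈ U ∧ e.2 ∈ U

end STGraph

/-! ### The binary tree -/

/-- Rooted full binary trees whose internal nodes store a capacity and whose leaves are
associated with sets of vertices. -/
inductive CapTree (V : Type*) where
  | leaf (S : Finset V) : CapTree V
  | node (cap : ℝ) (left right : CapTree V) : CapTree V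

namespace CapTree

variable {V : Type*} [DecidableEq V]

/-- The vertices mapped to the leaves of a tree. -/
def verts : CapTree V → Finset V
  | leaf S => S
  | node _ l r => l.verts ∪ r.verts

/-- The number of nodes, internal nodes and leaves together. -/
def numNodes : CapTree V → ℕ
  | leaf _ => 1
  | node _ l r => l.numNodes + r.numNodes + 1

/-- The subtree rooted at the lowest common ancestor of the leaves of `u` and `v`. It is a leaf
exactly if `u` and `v` are mapped to the same leaf. -/
def lca : CapTree V → V → V → CapTree V
  | leaf S, _, _ => leaf S
  | node c l r, u, v =>
    if u ∈ l.verts ∧ v ∈ l.verts then l.lca u v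
    else if u ∈ r.verts ∧ v ∈ r.verts then r.lca u v
    else node c l r

end CapTree

/-- `IsVitTree G U T`: the tree `T` is a possible outcome of the recursive construction on the
vertex set `U`. If no vital edge has both endpoints in `U`, a leaf for `U` is returned. Otherwise
a vital edge `e` inside `U` is selected whose mincut `C` has least capacity among the mincuts for
the vital edges inside `U`; the root stores the capacity of `C`, and the left and right subtrees
are constructed from `U ∩ C` and `U \ C`. -/
inductive IsVitTree {V : Type*} [Fintype V] [DecidableEq V] (G : STGraph V) :
    Finset V → CapTree V → Prop
  | leaf (U : Finset V) (h : ∀ e, ¬ G.IsVitalIn U e) : IsVitTree G U (CapTree.leaf U)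
  | node (U : Finset V) (e : V × V) (C : Finset V) (l r : CapTree V)
      (he : G.IsVitalIn U e) (hC : G.IsMinCutFor C e)
      (hmin : ∀ e' C', G.IsVitalIn U e' → G.IsMinCutFor C' e' →
        G.cutCapacity C ≤ G.cutCapacity C')
      (hl : IsVitTree G (U ∩ C) l) (hr : IsVitTree G (U \ C) r) :
      IsVitTree G U (CapTree.node (G.cutCapacity C) l r)

/-! ### The machine: a word RAM with additional cells for capacities

Words are `w`-bit numbers with the usual word operations. Capacities are kept in separate cells
and registers, which can only be loaded, added, subtracted and compared; in particular there is no
way to convert a capacity to a word, and the bits of a capacity are inaccessible. -/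

namespace CapRAM

/-- A static data structure: an array of words and an array of capacities. -/
structure Data where
  words : List ℕ
  reals : List ℝ

/-- The number of memory cells occupied. -/
def Data.size (D : Data) : ℕ := D.words.length + D.reals.length

/-- Every stored word has at most `w` bits. -/
def Data.FitsWords (D : Data) (w : ℕ) : Prop := ∀ x ∈ D.words, x < 2 ^ w

/-- Operations on words. -/
inductive WordOp where
  | add | sub | mul | div | mod | and | or | xor | shl | shr

/-- The value of a word operation on `w`-bit words (arithmetic modulo `2 ^ w`). -/
def WordOp.eval (w : ℕ) : WordOp → ℕ → ℕ → ℕ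
  | add, a, b => (a + b) % 2 ^ w
  | sub, a, b => (a + 2 ^ w - b) % 2 ^ w
  | mul, a, b => (a * b) % 2 ^ w
  | div, a, b => a / b
  | mod, a, b => a % b
  | and, a, b => a &&& b
  | or, a, b => a ||| b
  | xor, a, b => a ^^^ b
  | shl, a, b => (a <<< b) % 2 ^ w
  | shr, a, b => a >>> b

/-- Instructions. Register numbers `d a b`, constants `k` and jump targets `target` are fixed in
the program. -/
inductive Instr where
  /-- word register `d` becomes the constant `k` -/
  | const (d k : ℕ)
  /-- word register `d` becomes the result of `op` on word registers `a` and `b` -/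
  | word (op : WordOp) (d a b : ℕ)
  /-- word register `d` becomes the stored word whose address is in word register `a` -/
  | loadWord (d a : ℕ)
  /-- real register `d` becomes the stored capacity whose address is in word register `a` -/
  | loadReal (d a : ℕ)
  /-- real register `d` becomes the sum of real registers `a` and `b` -/
  | addReal (d a b : ℕ)
  /-- real register `d` becomes the difference of real registers `a` and `b` -/
  | subReal (d a b : ℕ)
  /-- jump if word register `a` equals word register `b` -/
  | jumpEq (a b target : ℕ)
  /-- jump if word register `a` is less than word register `b` -/
  | jumpLt (a b target : ℕ)
  /-- jump if real register `a` is less than real register `b` -/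
  | jumpLtReal (a b target : ℕ)

/-- A program is a finite list of instructions. -/
abbrev Program := List Instr

/-- Program counter, word registers, real registers. -/
structure State where
  pc : ℕ
  wreg : ℕ → ℕ
  rreg : ℕ → ℝ

/-- The effect of one instruction. -/
noncomputable def Instr.exec (w : ℕ) (D : Data) (σ : State) : Instr → State
  | const d k => ⟨σ.pc + 1, Function.update σ.wreg d (k % 2 ^ w), σ.rreg⟩
  | word op d a b =>
      ⟨σ.pc + 1, Function.update σ.wreg d (op.eval w (σ.wreg a) (σ.wreg b)), σ.rreg⟩
  | loadWord d a =>
      ⟨σ.pc + 1, Function.update σ.wreg d (D.words.getD (σ.wreg a) 0), σ.rreg⟩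
  | loadReal d a =>
      ⟨σ.pc + 1, σ.wreg, Function.update σ.rreg d (D.reals.getD (σ.wreg a) 0)⟩
  | addReal d a b =>
      ⟨σ.pc + 1, σ.wreg, Function.update σ.rreg d (σ.rreg a + σ.rreg b)⟩
  | subReal d a b =>
      ⟨σ.pc + 1, σ.wreg, Function.update σ.rreg d (σ.rreg a - σ.rreg b)⟩
  | jumpEq a b target =>
      ⟨if σ.wreg a = σ.wreg b then target else σ.pc + 1, σ.wreg, σ.rreg⟩
  | jumpLt a b target =>
      ⟨if σ.wreg a < σ.wreg b then target else σ.pc + 1, σ.wreg, σ.rreg⟩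
  | jumpLtReal a b target =>
      ⟨if σ.rreg a < σ.rreg b then target else σ.pc + 1, σ.wreg, σ.rreg⟩

/-- One step; a machine whose program counter is outside the program has halted. -/
noncomputable def step (w : ℕ) (D : Data) (P : Program) (σ : State) : State :=
  match P[σ.pc]? with
  | some i => i.exec w D σ
  | none => σ

/-- The start state of a query with two vertex numbers and one real number: they are placed in
the word registers `0` and `1` and the real register `0`; all other registers are zero. -/
def start (u v : ℕ) (x : ℝ) : State where
  pc := 0
  wreg := fun i => if i = 0 then u else if i = 1 then v else 0
  rreg := fun i => if i = 0 then x else 0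

/-- Run on the input `(u, v, x)`, the program halts within `k` steps, with a final state that
satisfies `Q`. -/
def Answers (w : ℕ) (D : Data) (P : Program) (k u v : ℕ) (x : ℝ) (Q : State → Prop) : Prop :=
  P.length ≤ ((step w D P)^[k] (start u v x)).pc ∧ Q ((step w D P)^[k] (start u v x))

end CapRAM

/-!
An edge `e` is vital if and only if it contributes to some cut `C` with `c(C) - w(e) < f*`. Let `C`
be a mincut for a vital edge. Uncrossing `C` with a mincut for another vital edge shows that no
vital edge enters `C` (`STGraph.IsMinCutFor.not_enters`, by submodularity). So a vital edge that is
split at a node of the tree leaves the cut of that node, and since the capacity of this cut was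
least among the candidates, the cut is a mincut for the edge as well (`IsVitTree.lca_of_isVitalIn`).

For the data structure, capacities do not decrease from a node of the tree to its children. Hence, if
the leaves are numbered from left to right and the stored capacities are listed in symmetric order,
the order of two leaf numbers tells the sides of two vertices below their lowest common ancestor,
and the capacity stored there is the minimum of the list between the two numbers
(`IsVitTree.lca_node`). Range minima are answered in constant time from linear space as usual:
the list is cut into blocks of logarithmic length. A range of at most this length is answered by a
bit mask of prefix minima, whose most significant bit after truncation to the range is the argmin
(`rangeMin_of_prefixMinMask`). A range that meets two blocks is covered by a suffix and a prefix of
a block and by two ranges of whole blocks that meet at a multiple of a power of two, this power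
being the most significant bit in which the two block numbers differ
(`CapRAM.rangeMin_of_blocks`). Logarithms are tabulated.

When the capacity of `e = (u, v)` changes by `Δ`, the new mincut capacity is the least of
`f + Δ`, where `f` is the mincut capacity of `e`, the least capacity of a cut that avoids `u`, and
the least capacity of a cut that contains `v`; the last two are stored for every vertex. If `e` is
not vital, the answer is `f*`, which the same formula gives with the capacity of any cut to which
`e` contributes instead of `f`. So the formula is correct whenever `u` is to the left of `v`, and
otherwise the answer is `f*`; the query needs neither `w(e)` nor a test of vitality
(`STGraph.minCutCapacity_setCapacity_eq`).

Programs are verified by symbolic execution: `CapRAM.Reaches` is a bounded reachability predicate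
with one rule for every instruction.
-/

/-! ### Cuts and vital edges -/

namespace STGraph

variable {V : Type*} [Fintype V] [DecidableEq V] {G : STGraph V}

theorem mem_cuts {C : Finset V} : C ∈ G.cuts ↔ G.IsCut C := by simp [cuts]

theorem minCutCapacity_le {C : Finset V} (hC : G.IsCut C) :
    G.minCutCapacity ≤ G.cutCapacity C :=
  Finset.inf'_le _ (mem_cuts.2 hC)

theorem exists_cutCapacity_eq_minCutCapacity (G : STGraph V) :
    ∃ C, G.IsCut C ∧ G.cutCapacity C = G.minCutCapacity := by
  obtain ⟨C, hC, h⟩ := Finset.exists_mem_eq_inf' G.cuts_nonempty G.cutCapacity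
  exact ⟨C, mem_cuts.1 hC, h.symm⟩

theorem le_minCutCapacity {x : ℝ} (h : ∀ C, G.IsCut C → x ≤ G.cutCapacity C) :
    x ≤ G.minCutCapacity :=
  Finset.le_inf' _ _ fun C hC => h C (mem_cuts.1 hC)

omit [Fintype V] in
theorem cutCapacity_eq_sum (G : STGraph V) (C : Finset V) :
    G.cutCapacity C = ∑ e ∈ G.edges, if e.1 ∈ C ∧ e.2 ∉ C then G.cap e else 0 := by
  rw [cutCapacity, Finset.sum_filter]
  refine Finset.sum_congr rfl fun e he => ?_
  simp [Contributes, he]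

omit [Fintype V] in
theorem cutCapacity_removeEdge {e : V × V} (he : e ∈ G.edges) (C : Finset V) :
    (G.removeEdge e).cutCapacity C =
      G.cutCapacity C - if G.Contributes e C then G.cap e else 0 := by
  rw [cutCapacity_eq_sum, cutCapacity_eq_sum]
  simp only [removeEdge, Contributes, he, true_and]
  exact Finset.sum_erase_eq_sub he

omit [Fintype V] in
theorem cutCapacity_setCapacity {e : V × V} (he : e ∈ G.edges) (x : ℝ) (C : Finset V) :
    (G.setCapacity e (G.cap e + x)).cutCapacity C =
      G.cutCapacity C + if G.Contributes e C then x else 0 := by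
  rw [cutCapacity_eq_sum, cutCapacity_eq_sum]
  have h : (if G.Contributes e C then x else 0) =
      ∑ a ∈ G.edges, if a = e then (if G.Contributes e C then x else 0) else 0 := by
    rw [Finset.sum_ite_eq' G.edges e, if_pos he]
  rw [h, ← Finset.sum_add_distrib]
  refine Finset.sum_congr rfl fun a ha => ?_
  by_cases hae : a = e
  · subst hae
    by_cases hc : a.1 ∈ C ∧ a.2 ∉ C <;> simp [setCapacity, Contributes, he, hc]
  · simp [setCapacity, hae]

theorem isVital_iff {e : V × V} (he : e ∈ G.edges) :
    G.IsVital e ↔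
      ∃ C, G.IsCut C ∧ G.Contributes e C ∧ G.cutCapacity C - G.cap e < G.minCutCapacity := by
  constructor
  · rintro ⟨-, h⟩
    obtain ⟨C, hC, hc⟩ := exists_cutCapacity_eq_minCutCapacity (G.removeEdge e)
    have hC' : G.IsCut C := hC
    rw [← hc, cutCapacity_removeEdge he] at h
    by_cases hcon : G.Contributes e C
    · exact ⟨C, hC', hcon, by simpa [hcon] using h⟩
    · have := minCutCapacity_le hC'
      simp only [hcon, if_false] at h
      linarith
  · rintro ⟨C, hC, hcon, h⟩
    refine ⟨he, lt_of_le_of_lt (minCutCapacity_le (G := G.removeEdge e) (C := C) hC) ?_⟩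
    rw [cutCapacity_removeEdge he, if_pos hcon]
    exact h

theorem IsMinCutFor.lt_of_isVital {e : V × V} {C : Finset V} (hC : G.IsMinCutFor C e)
    (he : G.IsVital e) : G.cutCapacity C - G.cap e < G.minCutCapacity := by
  obtain ⟨C', h1, h2, h3⟩ := (isVital_iff he.1).1 he
  linarith [hC.2.2 C' h1 h2]

theorem exists_least_cut {p : Finset V → Prop} (h : ∃ C, G.IsCut C ∧ p C) :
    ∃ C, G.IsCut C ∧ p C ∧ ∀ C', G.IsCut C' → p C' → G.cutCapacity C ≤ G.cutCapacity C' := by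
  classical
  obtain ⟨C, h1, h2⟩ := h
  obtain ⟨D, hD, hmin⟩ := Finset.exists_min_image
    (Finset.univ.filter fun C => G.IsCut C ∧ p C) G.cutCapacity ⟨C, by simp [h1, h2]⟩
  simp only [Finset.mem_filter, Finset.mem_univ, true_and] at hD hmin
  exact ⟨D, hD.1, hD.2, fun C' h h' => hmin C' ⟨h, h'⟩⟩

theorem IsVital.exists_isMinCutFor {e : V × V} (he : G.IsVital e) :
    ∃ C, G.IsMinCutFor C e := by
  obtain ⟨C, h1, h2, -⟩ := (isVital_iff he.1).1 he
  exact exists_least_cut ⟨C, h1, h2⟩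

/-- The total capacity of the edges that lead from `A \ B` to `B \ A`. -/
def crossCapacity (G : STGraph V) (A B : Finset V) : ℝ :=
  ∑ e ∈ G.edges, if e.1 ∈ A \ B ∧ e.2 ∈ B \ A then G.cap e else 0

omit [Fintype V] in
/-- Submodularity of the cut capacity, with the slack made explicit. -/
theorem cutCapacity_inter_add_union (G : STGraph V) (A B : Finset V) :
    G.cutCapacity (A ∩ B) + G.cutCapacity (A ∪ B) + G.crossCapacity A B + G.crossCapacity B A =
      G.cutCapacity A + G.cutCapacity B := by
  simp only [cutCapacity_eq_sum, crossCapacity, ← Finset.sum_add_distrib]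
  refine Finset.sum_congr rfl fun e _ => ?_
  by_cases h1 : e.1 ∈ A <;> by_cases h2 : e.1 ∈ B <;> by_cases h3 : e.2 ∈ A <;>
    by_cases h4 : e.2 ∈ B <;> simp [h1, h2, h3, h4]

omit [Fintype V] in
theorem crossCapacity_nonneg (hpos : ∀ e ∈ G.edges, 0 < G.cap e) (A B : Finset V) :
    0 ≤ G.crossCapacity A B :=
  Finset.sum_nonneg fun e he => by
    split_ifs
    · exact (hpos e he).le
    · exact le_rfl

omit [Fintype V] in
theorem cap_le_crossCapacity (hpos : ∀ e ∈ G.edges, 0 < G.cap e) {A B : Finset V} {e : V × V}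
    (he : e ∈ G.edges) (h1 : e.1 ∈ A \ B) (h2 : e.2 ∈ B \ A) :
    G.cap e ≤ G.crossCapacity A B := by
  have h := Finset.single_le_sum
    (f := fun e => if e.1 ∈ A \ B ∧ e.2 ∈ B \ A then G.cap e else 0) (fun e he => by
      split_ifs
      · exact (hpos e he).le
      · exact le_rfl) he
  rw [crossCapacity]
  simpa only [h1, h2, and_self, if_true] using h

omit [Fintype V] in
theorem IsCut.inter {A B : Finset V} (hA : G.IsCut A) (hB : G.IsCut B) : G.IsCut (A ∩ B) :=
  ⟨Finset.mem_inter.2 ⟨hA.1, hB.1⟩, fun h => hA.2 (Finset.mem_inter.1 h).1⟩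

omit [Fintype V] in
theorem IsCut.union {A B : Finset V} (hA : G.IsCut A) (hB : G.IsCut B) : G.IsCut (A ∪ B) :=
  ⟨Finset.mem_union_left _ hA.1, fun h => (Finset.mem_union.1 h).elim hA.2 hB.2⟩

/-- A mincut for a vital edge is not entered by any vital edge. If `e'` entered the mincut `C` for
`e`, uncrossing `C` with a mincut for `e'` would save `w(e')`, and in addition `w(e)` in case `e`
contributes neither to the intersection nor to the union; this contradicts vitality. -/
theorem IsMinCutFor.not_enters (hpos : ∀ e ∈ G.edges, 0 < G.cap e) {C : Finset V}
    {e e' : V × V} (hC : G.IsMinCutFor C e) (he : G.IsVital e) (he' : G.IsVital e') :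
    ¬ (e'.1 ∉ C ∧ e'.2 ∈ C) := by
  rintro ⟨h1, h2⟩
  obtain ⟨C', hC'⟩ := he'.exists_isMinCutFor
  have hlt := hC.lt_of_isVital he
  have hlt' := hC'.lt_of_isVital he'
  have hsub := cutCapacity_inter_add_union G C C'
  have hcross : G.cap e' ≤ G.crossCapacity C' C :=
    cap_le_crossCapacity hpos he'.1 (by simp [h1, hC'.2.1.2.1]) (by simp [h2, hC'.2.1.2.2])
  have hnn := crossCapacity_nonneg hpos C C'
  have hi := hC.1.inter hC'.1
  have hu := hC.1.union hC'.1
  have hi' := minCutCapacity_le hi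
  have hu' := minCutCapacity_le hu
  have he1 := hC.2.1.2.1
  have he2 := hC.2.1.2.2
  by_cases h3 : e.1 ∈ C'
  · have := hC.2.2 _ hi ⟨he.1, by simp [he1, h3], by simp [he2]⟩
    linarith
  · by_cases h4 : e.2 ∈ C'
    · have := cap_le_crossCapacity hpos (A := C) (B := C') he.1 (by simp [he1, h3])
        (by simp [he2, h4])
      linarith
    · have := hC.2.2 _ hu ⟨he.1, by simp [he1], by simp [he2, h4]⟩
      linarith

/-! ### Changing the capacity of one edge -/

theorem minCutCapacity_setCapacity_of_not_isVital (hpos : ∀ e ∈ G.edges, 0 < G.cap e)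
    {e : V × V} (he : e ∈ G.edges) (hv : ¬ G.IsVital e) {x : ℝ} (hx : -G.cap e ≤ x) :
    (G.setCapacity e (G.cap e + x)).minCutCapacity = G.minCutCapacity := by
  rw [isVital_iff he] at hv
  push Not at hv
  obtain ⟨C, hC, hmin⟩ := exists_cutCapacity_eq_minCutCapacity G
  have hcon : ¬ G.Contributes e C := fun h => by linarith [hv C hC h, hpos e he]
  apply le_antisymm
  · refine (minCutCapacity_le (G := G.setCapacity e (G.cap e + x)) (C := C) hC).trans_eq ?_
    rw [cutCapacity_setCapacity he, if_neg hcon, add_zero, hmin]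
  · refine le_minCutCapacity fun C' hC' => ?_
    replace hC' : G.IsCut C' := hC'
    rw [cutCapacity_setCapacity he]
    split_ifs with h
    · linarith [hv C' hC' h]
    · simpa using minCutCapacity_le hC'

/-- The mincut capacity after a change of `w(e)` by `x` is the least of `c(C) + x`, where `C` is a
mincut for `e`, and the capacities of the cuts to which `e` does not contribute. If `e` is not
vital, then any cut to which `e` contributes can take the role of `C`: the minimum is attained by
the other cuts. -/
theorem minCutCapacity_setCapacity_eq (hpos : ∀ e ∈ G.edges, 0 < G.cap e)
    {e : V × V} (he : e ∈ G.edges) {x y : ℝ} (hx : -G.cap e ≤ x) {C : Finset V} (hC : G.IsCut C)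
    (hcon : G.Contributes e C)
    (hmin : G.IsVital e → ∀ C', G.IsCut C' → G.Contributes e C' →
      G.cutCapacity C ≤ G.cutCapacity C')
    (hle : y ≤ G.cutCapacity C + x)
    (hle' : ∀ C', G.IsCut C' → e.1 ∉ C' ∨ e.2 ∈ C' → y ≤ G.cutCapacity C')
    (hy : y = G.cutCapacity C + x ∨
      ∃ C', G.IsCut C' ∧ (e.1 ∉ C' ∨ e.2 ∈ C') ∧ y = G.cutCapacity C') :
    (G.setCapacity e (G.cap e + x)).minCutCapacity = y := by
  apply le_antisymm
  · rcases hy with rfl | ⟨C', hC', h, rfl⟩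
    · refine (minCutCapacity_le (G := G.setCapacity e (G.cap e + x)) (C := C) hC).trans_eq ?_
      rw [cutCapacity_setCapacity he, if_pos hcon]
    · refine (minCutCapacity_le (G := G.setCapacity e (G.cap e + x)) (C := C') hC').trans_eq ?_
      rw [cutCapacity_setCapacity he, if_neg, add_zero]
      rintro ⟨-, h1, h2⟩
      tauto
  · by_cases hv : G.IsVital e
    · refine le_minCutCapacity fun C' hC' => ?_
      rw [cutCapacity_setCapacity he]
      split_ifs with h
      · linarith [hmin hv C' hC' h]
      · rw [add_zero]
        refine hle' C' hC' ?_
        by_contra hn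
        push Not at hn
        exact h ⟨he, hn⟩
    · rw [minCutCapacity_setCapacity_of_not_isVital hpos he hv hx]
      rw [isVital_iff he] at hv
      push Not at hv
      obtain ⟨C', hC', h⟩ := exists_cutCapacity_eq_minCutCapacity G
      rw [← h]
      refine hle' C' hC' ?_
      by_contra hn
      push Not at hn
      linarith [hv C' hC' ⟨he, hn⟩, hpos e he]

/-- Every vertex `u` other than the source has a least capacity of the cuts that avoid it. -/
theorem exists_least_avoiding (G : STGraph V) : ∃ a : V → ℝ, ∀ u, u ≠ G.source →
    (∃ C, G.IsCut C ∧ u ∉ C ∧ a u = G.cutCapacity C) ∧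
      ∀ C, G.IsCut C → u ∉ C → a u ≤ G.cutCapacity C := by
  have h : ∀ u, ∃ x : ℝ, u ≠ G.source →
      (∃ C, G.IsCut C ∧ u ∉ C ∧ x = G.cutCapacity C) ∧
        ∀ C, G.IsCut C → u ∉ C → x ≤ G.cutCapacity C := fun u => by
    by_cases hu : u = G.source
    · exact ⟨0, fun h => absurd hu h⟩
    · obtain ⟨C, h1, h2, h3⟩ := exists_least_cut (G := G) (p := fun C => u ∉ C)
        ⟨{G.source}, ⟨by simp, by simpa using G.source_ne_sink.symm⟩, by simpa using hu⟩
      exact ⟨_, fun _ => ⟨⟨C, h1, h2, rfl⟩, h3⟩⟩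
  choose a ha using h
  exact ⟨a, ha⟩

/-- Every vertex `v` other than the sink has a least capacity of the cuts that contain it. -/
theorem exists_least_hitting (G : STGraph V) : ∃ b : V → ℝ, ∀ v, v ≠ G.sink →
    (∃ C, G.IsCut C ∧ v ∈ C ∧ b v = G.cutCapacity C) ∧
      ∀ C, G.IsCut C → v ∈ C → b v ≤ G.cutCapacity C := by
  have h : ∀ v, ∃ x : ℝ, v ≠ G.sink →
      (∃ C, G.IsCut C ∧ v ∈ C ∧ x = G.cutCapacity C) ∧
        ∀ C, G.IsCut C → v ∈ C → x ≤ G.cutCapacity C := fun v => by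
    by_cases hv : v = G.sink
    · exact ⟨0, fun h => absurd hv h⟩
    · obtain ⟨C, h1, h2, h3⟩ := exists_least_cut (G := G) (p := fun C => v ∈ C)
        ⟨{G.sink}ᶜ, ⟨by simpa using G.source_ne_sink, by simp⟩, by simpa using hv⟩
      exact ⟨_, fun _ => ⟨⟨C, h1, h2, rfl⟩, h3⟩⟩
  choose b hb using h
  exact ⟨b, hb⟩

end STGraph

/-! ### Shape of the tree -/

namespace IsVitTree

open STGraph

variable {V : Type*} [Fintype V] [DecidableEq V] {G : STGraph V} {U : Finset V} {T : CapTree V}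

theorem verts_eq (h : IsVitTree G U T) : T.verts = U := by
  induction h with
  | leaf U h => rfl
  | node U e C l r he hC hmin hl hr ihl ihr =>
    rw [CapTree.verts, ihl, ihr]
    ext x
    by_cases x ∈ C <;> simp [*]

theorem exists_tree (G : STGraph V) (U : Finset V) : ∃ T, IsVitTree G U T := by
  classical
  induction U using Finset.strongInduction with
  | H U ih =>
    by_cases h : ∀ e, ¬ G.IsVitalIn U e
    · exact ⟨_, .leaf U h⟩
    · push Not at h
      obtain ⟨e₀, he₀⟩ := h
      obtain ⟨C₀, hC₀⟩ := he₀.1.exists_isMinCutFor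
      obtain ⟨C, hC, hmin⟩ := Finset.exists_min_image
        (Finset.univ.filter fun C => ∃ e, G.IsVitalIn U e ∧ G.IsMinCutFor C e) G.cutCapacity
        ⟨C₀, by simpa using ⟨e₀.1, e₀.2, he₀, hC₀⟩⟩
      simp only [Finset.mem_filter, Finset.mem_univ, true_and] at hC hmin
      obtain ⟨e, he, hCe⟩ := hC
      obtain ⟨l, hl⟩ := ih (U ∩ C) <| Finset.ssubset_iff_subset_ne.2
        ⟨Finset.inter_subset_left, fun h => hCe.2.1.2.2
          (Finset.mem_inter.1 (h.symm ▸ he.2.2 : e.2 ∈ U ∩ C)).2⟩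
      obtain ⟨r, hr⟩ := ih (U \ C) <| Finset.ssubset_iff_subset_ne.2
        ⟨Finset.sdiff_subset, fun h => (Finset.mem_sdiff.1
          (h.symm ▸ he.2.1 : e.1 ∈ U \ C)).2 hCe.2.1.2.1⟩
      exact ⟨_, .node U e C l r he hCe (fun e' C' h h' => hmin C' ⟨e', h, h'⟩) hl hr⟩

theorem numNodes_lt (h : IsVitTree G U T) (hU : U.Nonempty) : T.numNodes < 2 * U.card := by
  induction h with
  | leaf U h =>
    have := hU.card_pos
    simp only [CapTree.numNodes]
    omega
  | node U e C l r he hC hmin hl hr ihl ihr =>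
    have h1 := ihl ⟨e.1, by simp [he.2.1, hC.2.1.2.1]⟩
    have h2 := ihr ⟨e.2, by simp [he.2.2, hC.2.1.2.2]⟩
    have h3 := Finset.card_inter_add_card_sdiff U C
    simp only [CapTree.numNodes]
    omega

/-- A vital edge is split at some node of the tree, from left to right, and the cut of that node
is a mincut for it. -/
theorem lca_of_isVitalIn (hpos : ∀ e ∈ G.edges, 0 < G.cap e) (h : IsVitTree G U T) {e : V × V}
    (he : G.IsVitalIn U e) :
    ∃ C l r, G.IsMinCutFor C e ∧ T.lca e.1 e.2 = .node (G.cutCapacity C) l r ∧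
      e.1 ∈ l.verts ∧ e.2 ∈ r.verts := by
  induction h with
  | leaf U h => exact absurd he (h e)
  | node U e' C l r he' hC hmin hl hr ihl ihr =>
    obtain ⟨hv, h1, h2⟩ := he
    by_cases c1 : e.1 ∈ C <;> by_cases c2 : e.2 ∈ C
    · obtain ⟨C', l', r', h⟩ := ihl ⟨hv, by simp [*], by simp [*]⟩
      exact ⟨C', l', r', by simpa [CapTree.lca, hl.verts_eq, h1, h2, c1, c2] using h⟩
    · obtain ⟨D, hD⟩ := hv.exists_isMinCutFor
      refine ⟨C, l, r, ⟨hC.1, ⟨hv.1, c1, c2⟩, fun C' h h' => ?_⟩, ?_, ?_, ?_⟩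
      · exact (hmin e D ⟨hv, h1, h2⟩ hD).trans (hD.2.2 C' h h')
      · simp [CapTree.lca, hl.verts_eq, hr.verts_eq, c1, c2]
      · simp [hl.verts_eq, h1, c1]
      · simp [hr.verts_eq, h2, c2]
    · exact absurd ⟨c1, c2⟩ (hC.not_enters hpos he'.1 hv)
    · obtain ⟨C', l', r', h⟩ := ihr ⟨hv, by simp [*], by simp [*]⟩
      exact ⟨C', l', r', by
        simpa [CapTree.lca, hl.verts_eq, hr.verts_eq, h1, h2, c1, c2] using h⟩

/-- Every internal lowest common ancestor stores the capacity of a cut that separates the vertices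
of its left subtree from those of its right subtree. -/
theorem exists_cut_of_lca (h : IsVitTree G U T) {u v : V} {c : ℝ} {l r : CapTree V}
    (hT : T.lca u v = .node c l r) :
    ∃ C, G.IsCut C ∧ G.cutCapacity C = c ∧ (∀ x ∈ l.verts, x ∈ C) ∧ ∀ x ∈ r.verts, x ∉ C := by
  induction h with
  | leaf U h => simp [CapTree.lca] at hT
  | node U e' C l' r' he' hC hmin hl hr ihl ihr =>
    rw [CapTree.lca] at hT
    split_ifs at hT
    · exact ihl hT
    · exact ihr hT
    · injection hT with h1 h2 h3
      subst h1 h2 h3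
      exact ⟨C, hC.1, rfl, by simp +contextual [hl.verts_eq], by simp +contextual [hr.verts_eq]⟩

theorem isVital_iff_lca (hpos : ∀ e ∈ G.edges, 0 < G.cap e) (h : IsVitTree G Finset.univ T)
    {e : V × V} (he : e ∈ G.edges) :
    G.IsVital e ↔ ∃ c l r, T.lca e.1 e.2 = .node c l r ∧
      e.1 ∈ l.verts ∧ e.2 ∈ r.verts ∧ c - G.cap e < G.minCutCapacity := by
  constructor
  · intro hv
    obtain ⟨C, l, r, hC, hT, h1, h2⟩ := h.lca_of_isVitalIn hpos ⟨hv, by simp, by simp⟩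
    exact ⟨_, l, r, hT, h1, h2, hC.lt_of_isVital hv⟩
  · rintro ⟨c, l, r, hT, h1, h2, hlt⟩
    obtain ⟨C, hC, rfl, hl, hr⟩ := h.exists_cut_of_lca hT
    exact (isVital_iff he).2 ⟨C, hC, ⟨he, hl _ h1, hr _ h2⟩, hlt⟩

end IsVitTree

/-! ### The lowest common ancestor as a range minimum -/

namespace CapTree

variable {V : Type*} [DecidableEq V]

/-- The stored capacities in symmetric order. Between two consecutive leaves there is exactly
one internal node, their lowest common ancestor; the entry with index `k` belongs to the leaves
number `k` and `k + 1`. -/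
def caps : CapTree V → List ℝ
  | leaf _ => []
  | node c l r => l.caps ++ c :: r.caps

/-- The number, from left to right and starting with `0`, of the leaf to which `u` is mapped. -/
def leafIdx : CapTree V → V → ℕ
  | leaf _, _ => 0
  | node _ l r, u => if u ∈ l.verts then l.leafIdx u else l.caps.length + 1 + r.leafIdx u

theorem leafIdx_le (T : CapTree V) (u : V) : T.leafIdx u ≤ T.caps.length := by
  induction T with
  | leaf S => simp [leafIdx, caps]
  | node c l r ihl ihr =>
    simp only [leafIdx, caps, List.length_append, List.length_cons]
    split_ifs <;> omega

omit [DecidableEq V] in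
theorem numNodes_eq (T : CapTree V) : T.numNodes = 2 * T.caps.length + 1 := by
  induction T with
  | leaf S => rfl
  | node c l r ihl ihr =>
    simp only [numNodes, caps, List.length_append, List.length_cons, ihl, ihr]
    omega

end CapTree

/-- `c` is the least of the entries of `L` with indices `i ≤ k < j`. -/
def IsLeastBetween (L : List ℝ) (i j : ℕ) (c : ℝ) : Prop :=
  (∃ k, i ≤ k ∧ k < j ∧ L.getD k 0 = c) ∧ ∀ k, i ≤ k → k < j → c ≤ L.getD k 0

namespace IsLeastBetween

variable {L R : List ℝ} {i j : ℕ} {c : ℝ}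

theorem lt (h : IsLeastBetween L i j c) : i < j := by
  obtain ⟨⟨k, h1, h2, -⟩, -⟩ := h
  omega

theorem append_right (h : IsLeastBetween L i j c) (hj : j ≤ L.length) (R : List ℝ) :
    IsLeastBetween (L ++ R) i j c := by
  have hget : ∀ k, k < j → (L ++ R).getD k 0 = L.getD k 0 := fun k hk =>
    List.getD_append _ _ _ _ (hk.trans_le hj)
  obtain ⟨⟨k, h1, h2, h3⟩, h4⟩ := h
  exact ⟨⟨k, h1, h2, by rw [hget k h2, h3]⟩, fun m hm hmj => by rw [hget m hmj]; exact h4 m hm hmj⟩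

theorem append_left (h : IsLeastBetween R i j c) (L : List ℝ) (d : ℝ) :
    IsLeastBetween (L ++ d :: R) (L.length + 1 + i) (L.length + 1 + j) c := by
  have hget : ∀ k, (L ++ d :: R).getD (L.length + 1 + k) 0 = R.getD k 0 := fun k => by
    rw [List.getD_append_right _ _ _ _ (by omega),
      show L.length + 1 + k - L.length = k + 1 by omega, List.getD_cons_succ]
  obtain ⟨⟨k, h1, h2, h3⟩, h4⟩ := h
  refine ⟨⟨L.length + 1 + k, by omega, by omega, by rw [hget, h3]⟩, fun m hm hmj => ?_⟩
  obtain ⟨m, rfl⟩ : ∃ m', m = L.length + 1 + m' := ⟨m - (L.length + 1), by omega⟩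
  rw [hget]
  exact h4 m (by omega) (by omega)

theorem split (h : ∀ x ∈ L ++ c :: R, c ≤ x) (hi : i ≤ L.length) (hj : j ≤ R.length) :
    IsLeastBetween (L ++ c :: R) i (L.length + 1 + j) c := by
  refine ⟨⟨L.length, hi, by omega, by simp⟩, fun k _ hk => ?_⟩
  have hk' : k < (L ++ c :: R).length := by
    rw [List.length_append, List.length_cons]
    omega
  rw [List.getD_eq_getElem _ _ hk']
  exact h _ (List.getElem_mem hk')

end IsLeastBetween

namespace IsVitTree

open STGraph

variable {V : Type*} [Fintype V] [DecidableEq V] {G : STGraph V} {U : Finset V} {T : CapTree V}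

theorem le_of_mem_caps (h : IsVitTree G U T) {c : ℝ}
    (hc : ∀ e C, G.IsVitalIn U e → G.IsMinCutFor C e → c ≤ G.cutCapacity C) :
    ∀ x ∈ T.caps, c ≤ x := by
  induction h with
  | leaf U h => simp [CapTree.caps]
  | node U e C l r he hC hmin hl hr ihl ihr =>
    intro x hx
    simp only [CapTree.caps, List.mem_append, List.mem_cons] at hx
    rcases hx with hx | rfl | hx
    · exact ihl (fun e' C' h h' => hc e' C' ⟨h.1, (Finset.mem_inter.1 h.2.1).1,
        (Finset.mem_inter.1 h.2.2).1⟩ h') x hx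
    · exact hc e C he hC
    · exact ihr (fun e' C' h h' => hc e' C' ⟨h.1, (Finset.mem_sdiff.1 h.2.1).1,
        (Finset.mem_sdiff.1 h.2.2).1⟩ h') x hx

theorem leafIdx_eq_of_lca_leaf (h : IsVitTree G U T) {u v : V} (hu : u ∈ U) (hv : v ∈ U)
    {S : Finset V} (hT : T.lca u v = .leaf S) : T.leafIdx u = T.leafIdx v := by
  induction h with
  | leaf U h => rfl
  | node U e C l r he hC hmin hl hr ihl ihr =>
    rw [CapTree.lca] at hT
    split_ifs at hT with h1 h2
    · simpa [CapTree.leafIdx, h1] using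
        ihl (hl.verts_eq ▸ h1.1) (hl.verts_eq ▸ h1.2) hT
    · have h1' : u ∉ l.verts := by
        have := h2.1; simp only [hr.verts_eq, hl.verts_eq] at this ⊢; simp_all
      have h2' : v ∉ l.verts := by
        have := h2.2; simp only [hr.verts_eq, hl.verts_eq] at this ⊢; simp_all
      simpa [CapTree.leafIdx, h1', h2'] using
        ihr (hr.verts_eq ▸ h2.1) (hr.verts_eq ▸ h2.2) hT

/-- Stored capacities do not decrease from a node to its children, because the children choose
among fewer vital edges. So the capacity at the lowest common ancestor of two leaves is the least
of those strictly between them in symmetric order, and the order of the leaves tells on which side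
each of them is. -/
theorem lca_node (h : IsVitTree G U T) {u v : V} (hu : u ∈ U) (hv : v ∈ U)
    {c : ℝ} {l r : CapTree V} (hT : T.lca u v = .node c l r) :
    (u ∈ l.verts ∧ v ∈ r.verts ∧ IsLeastBetween T.caps (T.leafIdx u) (T.leafIdx v) c) ∨
    (u ∉ l.verts ∧ IsLeastBetween T.caps (T.leafIdx v) (T.leafIdx u) c) := by
  induction h with
  | leaf U h => simp [CapTree.lca] at hT
  | node U e C l' r' he hC hmin hl hr ihl ihr =>
    have hroot := (IsVitTree.node U e C l' r' he hC hmin hl hr).le_of_mem_caps hmin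
    have hul : u ∈ l'.verts ↔ u ∉ r'.verts := by simp [hl.verts_eq, hr.verts_eq, hu]
    have hvl : v ∈ l'.verts ↔ v ∉ r'.verts := by simp [hl.verts_eq, hr.verts_eq, hv]
    rw [CapTree.lca] at hT
    split_ifs at hT with h1 h2
    · simp only [CapTree.leafIdx, h1, if_true, CapTree.caps]
      rcases ihl (hl.verts_eq ▸ h1.1) (hl.verts_eq ▸ h1.2) hT with ⟨i1, i2, i3⟩ | ⟨i1, i3⟩
      · exact .inl ⟨i1, i2, i3.append_right (l'.leafIdx_le v) _⟩
      · exact .inr ⟨i1, i3.append_right (l'.leafIdx_le u) _⟩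
    · have hu' : u ∉ l'.verts := by tauto
      have hv' : v ∉ l'.verts := by tauto
      simp only [CapTree.leafIdx, hu', hv', if_false, CapTree.caps]
      rcases ihr (hr.verts_eq ▸ h2.1) (hr.verts_eq ▸ h2.2) hT with ⟨i1, i2, i3⟩ | ⟨i1, i3⟩
      · exact .inl ⟨i1, i2, i3.append_left _ _⟩
      · exact .inr ⟨i1, i3.append_left _ _⟩
    · injection hT with e1 e2 e3
      subst e1 e2 e3
      by_cases hu' : u ∈ l'.verts
      · have hv' : v ∉ l'.verts := by tauto
        simp only [CapTree.leafIdx, hu', hv', if_false, if_true, CapTree.caps]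
        exact .inl ⟨trivial, by tauto, .split hroot (l'.leafIdx_le u) (r'.leafIdx_le v)⟩
      · have hv' : v ∈ l'.verts := by tauto
        simp only [CapTree.leafIdx, hu', hv', if_false, if_true, CapTree.caps]
        exact .inr ⟨not_false, .split hroot (l'.leafIdx_le v) (r'.leafIdx_le u)⟩

end IsVitTree

/-! ### Range minima from precomputed tables -/

/-- The least of the bound `M` and the values `A k` for `i ≤ k < j`. The bound makes the minimum
over an empty range meaningful; it will be chosen above all values of interest. -/
noncomputable def rangeMin (A : ℕ → ℝ) (M : ℝ) (i j : ℕ) : ℝ :=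
  (Finset.Ico i j).fold min M A

section

variable {A : ℕ → ℝ} {M : ℝ}

theorem le_rangeMin {x : ℝ} {i j : ℕ} :
    x ≤ rangeMin A M i j ↔ x ≤ M ∧ ∀ k, i ≤ k → k < j → x ≤ A k := by
  simp [rangeMin, Finset.le_fold_min]

theorem rangeMin_eq {i j k : ℕ} (hk : i ≤ k) (hkj : k < j) (hM : A k ≤ M)
    (h : ∀ m, i ≤ m → m < j → A k ≤ A m) : rangeMin A M i j = A k :=
  le_antisymm ((le_rangeMin.1 le_rfl).2 k hk hkj) (le_rangeMin.2 ⟨hM, h⟩)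

theorem min_rangeMin {i j k : ℕ} (h1 : i ≤ j) (h2 : j ≤ k) :
    min (rangeMin A M i j) (rangeMin A M j k) = rangeMin A M i k := by
  refine eq_of_forall_le_iff fun x => ?_
  simp only [le_min_iff, le_rangeMin]
  constructor
  · rintro ⟨⟨h, h3⟩, -, h4⟩
    exact ⟨h, fun m hm hm' => (lt_or_ge m j).elim (h3 m hm) fun h => h4 m h hm'⟩
  · rintro ⟨h, h3⟩
    exact ⟨⟨h, fun m hm hm' => h3 m hm (by omega)⟩, h, fun m hm hm' => h3 m (by omega) hm'⟩

open Classical in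
/-- The word whose bit `d < B` tells whether `A (i + d)` is less than all of `A i`, ...,
`A (i + d - 1)`, that is, whether it is a prefix minimum of the sequence that starts at `i`. -/
noncomputable def prefixMinMask (A : ℕ → ℝ) (B i : ℕ) : ℕ :=
  Nat.ofBits fun d : Fin B => decide (∀ m < (d : ℕ), A (i + d) < A (i + m))

theorem prefixMinMask_lt (A : ℕ → ℝ) (B i : ℕ) : prefixMinMask A B i < 2 ^ B :=
  Nat.ofBits_lt_two_pow _

theorem testBit_prefixMinMask {B i d : ℕ} (hd : d < B) :
    (prefixMinMask A B i).testBit d = true ↔ ∀ m < d, A (i + d) < A (i + m) := by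
  rw [prefixMinMask, Nat.testBit_ofBits_lt _ _ hd]
  simp

/-- The last prefix minimum of a sequence is its minimum. -/
theorem rangeMin_of_prefixMinMask {B i j : ℕ} (hij : i < j) (hjB : j ≤ i + B)
    (hM : ∀ k, i ≤ k → k < j → A k ≤ M) :
    i + Nat.log2 (prefixMinMask A B i % 2 ^ (j - i)) < j ∧
    rangeMin A M i j = A (i + Nat.log2 (prefixMinMask A B i % 2 ^ (j - i))) := by
  set m := prefixMinMask A B i % 2 ^ (j - i) with hm
  have hbit : ∀ d, m.testBit d = true ↔ d < j - i ∧ ∀ m < d, A (i + d) < A (i + m) := fun d => by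
    rw [hm, Nat.testBit_mod_two_pow]
    by_cases hd : d < j - i
    · simp [hd, testBit_prefixMinMask (show d < B by omega)]
    · simp [hd]
  have hm0 : m ≠ 0 := by
    intro h0
    have := (hbit 0).2 ⟨by omega, by simp⟩
    simp [h0] at this
  have hlog : m.testBit m.log2 = true := Nat.testBit_log2 hm0
  have htop : ∀ d, m.log2 < d → m.testBit d = false := fun d hd =>
    Nat.testBit_lt_two_pow (lt_of_lt_of_le Nat.lt_log2_self
      (Nat.pow_le_pow_right (by omega) (by omega)))
  set q := m.log2
  obtain ⟨hq, hqmin⟩ := (hbit q).1 hlog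
  refine ⟨by omega, rangeMin_eq (by omega) (by omega) (hM _ (by omega) (by omega)) ?_⟩
  have key : ∀ d, d < j - i → A (i + q) ≤ A (i + d) := by
    intro d
    induction d using Nat.strong_induction_on with
    | _ d ih =>
      intro hd
      rcases lt_trichotomy d q with h | rfl | h
      · exact (hqmin d h).le
      · exact le_rfl
      · have h0 := htop d h
        have h1 : ¬ ∀ m < d, A (i + d) < A (i + m) := fun h1 => by
          rw [(hbit d).2 ⟨hd, h1⟩] at h0
          simp at h0
        push Not at h1
        obtain ⟨p, hp, hpd⟩ := h1
        exact (ih p hp (by omega)).trans hpd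
  intro k hk hkj
  have := key (k - i) (by omega)
  rwa [show i + (k - i) = k by omega] at this

end

theorem eq_succ_of_xor_eq_one {a b : ℕ} (hab : a ≤ b) (h : a ^^^ b = 1) : b = a + 1 := by
  have h2 : a / 2 ^^^ b / 2 = 0 := by rw [← Nat.xor_div_two, h]
  rw [Nat.xor_eq_zero_iff] at h2
  have hne : a ≠ b := by
    rintro rfl
    simp at h
  omega

/-- The most significant bit in which `a < b` differ determines a multiple of a power of two
that separates them. -/
theorem div_eq_succ_div_of_log2_xor {a b : ℕ} (hab : a < b) :
    b / 2 ^ (a ^^^ b).log2 = a / 2 ^ (a ^^^ b).log2 + 1 := by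
  have hne : a ^^^ b ≠ 0 := by
    rw [Ne, Nat.xor_eq_zero_iff]
    omega
  apply eq_succ_of_xor_eq_one (Nat.div_le_div_right hab.le)
  rw [← Nat.shiftRight_eq_div_pow, ← Nat.shiftRight_eq_div_pow, ← Nat.shiftRight_xor_distrib,
    Nat.shiftRight_eq_div_pow]
  have h1 := Nat.log2_self_le hne
  have h2 := Nat.lt_log2_self (n := a ^^^ b)
  rw [pow_succ] at h2
  exact Nat.div_eq_of_lt_le (by omega) (by omega)

/-! ### Reasoning about machine programs -/

namespace CapRAM

variable {w k : ℕ} {D : Data} {P : Program} {Q R : State → Prop} {pc : ℕ} {wr : ℕ → ℕ}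
  {rr : ℕ → ℝ}

/-- From the state `σ` the machine reaches a state that satisfies `Q` within `k` steps. -/
def Reaches (w : ℕ) (D : Data) (P : Program) (k : ℕ) (σ : State) (Q : State → Prop) : Prop :=
  ∃ t ≤ k, Q ((step w D P)^[t] σ)

theorem Reaches.done {σ : State} (h : Q σ) : Reaches w D P k σ Q := ⟨0, Nat.zero_le _, h⟩

theorem Reaches.trans {k' : ℕ} {σ : State} (h : Reaches w D P k σ R)
    (h' : ∀ σ', R σ' → Reaches w D P k' σ' Q) : Reaches w D P (k + k') σ Q := by
  obtain ⟨t, ht, hR⟩ := h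
  obtain ⟨t', ht', hQ⟩ := h' _ hR
  exact ⟨t' + t, by omega, by rwa [Function.iterate_add_apply]⟩

theorem Reaches.mono {k' : ℕ} {σ : State} (h : Reaches w D P k σ Q) (hk : k ≤ k') :
    Reaches w D P k' σ Q := by
  obtain ⟨t, ht, hQ⟩ := h
  exact ⟨t, ht.trans hk, hQ⟩

theorem Reaches.step {i : Instr} (hi : P[pc]? = some i)
    (h : Reaches w D P k (i.exec w D ⟨pc, wr, rr⟩) Q) :
    Reaches w D P (k + 1) ⟨pc, wr, rr⟩ Q := by
  obtain ⟨t, ht, hQ⟩ := h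
  refine ⟨t + 1, by omega, ?_⟩
  rwa [Function.iterate_succ_apply, show CapRAM.step w D P ⟨pc, wr, rr⟩ =
    i.exec w D ⟨pc, wr, rr⟩ by simp only [CapRAM.step, hi]]

/-- A halted machine does not change its state, so that it suffices to halt early. -/
theorem Reaches.answers {u v : ℕ} {x : ℝ}
    (h : Reaches w D P k (start u v x) fun σ => P.length ≤ σ.pc ∧ Q σ) :
    Answers w D P k u v x Q := by
  obtain ⟨t, ht, hpc, hQ⟩ := h
  have hfix : CapRAM.step w D P ((CapRAM.step w D P)^[t] (start u v x)) =
      (CapRAM.step w D P)^[t] (start u v x) := by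
    rw [CapRAM.step, List.getElem?_eq_none hpc]
  have : (CapRAM.step w D P)^[k] (start u v x) = (CapRAM.step w D P)^[t] (start u v x) := by
    rw [← Nat.sub_add_cancel ht, Function.iterate_add_apply, Function.iterate_fixed hfix]
  rw [Answers, this]
  exact ⟨hpc, hQ⟩

theorem reaches_const {d c : ℕ} (hi : P[pc]? = some (.const d c)) (hc : c < 2 ^ w)
    (h : Reaches w D P k ⟨pc + 1, Function.update wr d c, rr⟩ Q) :
    Reaches w D P (k + 1) ⟨pc, wr, rr⟩ Q :=
  .step hi (by simpa only [Instr.exec, Nat.mod_eq_of_lt hc] using h)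

theorem reaches_word {op : WordOp} {d a b x y : ℕ} (hi : P[pc]? = some (.word op d a b)) (z : ℕ)
    (hx : wr a = x) (hy : wr b = y) (hz : op.eval w x y = z)
    (h : Reaches w D P k ⟨pc + 1, Function.update wr d z, rr⟩ Q) :
    Reaches w D P (k + 1) ⟨pc, wr, rr⟩ Q :=
  .step hi (by simpa only [Instr.exec, hx, hy, hz] using h)

theorem reaches_loadWord {d a x : ℕ} (hi : P[pc]? = some (.loadWord d a)) (z : ℕ)
    (hx : wr a = x) (hz : D.words.getD x 0 = z)
    (h : Reaches w D P k ⟨pc + 1, Function.update wr d z, rr⟩ Q) :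
    Reaches w D P (k + 1) ⟨pc, wr, rr⟩ Q :=
  .step hi (by simpa only [Instr.exec, hx, hz] using h)

theorem reaches_loadReal {d a x : ℕ} (hi : P[pc]? = some (.loadReal d a)) (z : ℝ)
    (hx : wr a = x) (hz : D.reals.getD x 0 = z)
    (h : Reaches w D P k ⟨pc + 1, wr, Function.update rr d z⟩ Q) :
    Reaches w D P (k + 1) ⟨pc, wr, rr⟩ Q :=
  .step hi (by simpa only [Instr.exec, hx, hz] using h)

theorem reaches_addReal {d a b : ℕ} (hi : P[pc]? = some (.addReal d a b)) (z : ℝ)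
    (hz : rr a + rr b = z)
    (h : Reaches w D P k ⟨pc + 1, wr, Function.update rr d z⟩ Q) :
    Reaches w D P (k + 1) ⟨pc, wr, rr⟩ Q :=
  .step hi (by simpa only [Instr.exec, hz] using h)

theorem reaches_jumpEq {a b t : ℕ} (hi : P[pc]? = some (.jumpEq a b t))
    (h1 : wr a = wr b → Reaches w D P k ⟨t, wr, rr⟩ Q)
    (h2 : wr a ≠ wr b → Reaches w D P k ⟨pc + 1, wr, rr⟩ Q) :
    Reaches w D P (k + 1) ⟨pc, wr, rr⟩ Q :=
  .step hi (by
    simp only [Instr.exec]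
    split_ifs with h
    exacts [h1 h, h2 h])

theorem reaches_jumpLt {a b t : ℕ} (hi : P[pc]? = some (.jumpLt a b t))
    (h1 : wr a < wr b → Reaches w D P k ⟨t, wr, rr⟩ Q)
    (h2 : ¬ wr a < wr b → Reaches w D P k ⟨pc + 1, wr, rr⟩ Q) :
    Reaches w D P (k + 1) ⟨pc, wr, rr⟩ Q :=
  .step hi (by
    simp only [Instr.exec]
    split_ifs with h
    exacts [h1 h, h2 h])

/-- Two instructions that replace a real register by its minimum with another one; the real
register `9` is never written and serves as the constant zero. -/
theorem reaches_min {a b t : ℕ} (hi : P[pc]? = some (.jumpLtReal a b t)) (ht : t = pc + 2)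
    (hi' : P[pc + 1]? = some (.addReal a b 9)) (x y : ℝ) (hx : rr a = x) (hy : rr b = y)
    (h9 : rr 9 = 0)
    (h : Reaches w D P k ⟨pc + 2, wr, Function.update rr a (min x y)⟩ Q) :
    Reaches w D P (k + 2) ⟨pc, wr, rr⟩ Q := by
  subst ht hx hy
  refine .step hi ?_
  simp only [Instr.exec]
  split_ifs with hlt
  · rw [min_eq_left hlt.le, Function.update_eq_self] at h
    exact h.mono (by omega)
  · refine reaches_addReal hi' (rr b) (by rw [h9, add_zero]) ?_
    rwa [min_eq_right (not_lt.1 hlt)] at h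

theorem eval_add {x y : ℕ} (h : x + y < 2 ^ w) : WordOp.add.eval w x y = x + y :=
  Nat.mod_eq_of_lt h

theorem eval_mul_eight {x : ℕ} (h : 8 * x < 2 ^ w) : WordOp.mul.eval w x 8 = 8 * x := by
  rw [WordOp.eval, mul_comm, Nat.mod_eq_of_lt h]

theorem eval_sub {x y : ℕ} (h : y ≤ x) (hx : x < 2 ^ w) : WordOp.sub.eval w x y = x - y := by
  rw [WordOp.eval, Nat.sub_add_comm h, Nat.add_mod_right, Nat.mod_eq_of_lt (by omega)]

theorem eval_one_shl {x : ℕ} (h : 2 ^ x < 2 ^ w) : WordOp.shl.eval w 1 x = 2 ^ x := by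
  rw [WordOp.eval, Nat.one_shiftLeft, Nat.mod_eq_of_lt h]

/-! ### The memory layout -/

/-- The memory contents that hold, for all `i < N`, the eight entries `f 0 i`, ..., `f 7 i` in
consecutive cells. -/
def packed {α : Type*} (N : ℕ) (f : ℕ → ℕ → α) : List α :=
  (List.range (8 * N)).map fun a => f (a % 8) (a / 8)

theorem packed_getD {α : Type*} {N : ℕ} {f : ℕ → ℕ → α} {i q : ℕ} (hi : i < N) (hq : q < 8)
    (d : α) : (packed N f).getD (8 * i + q) d = f q i := by
  have h : 8 * i + q < (packed N f).length := by
    rw [packed, List.length_map, List.length_range]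
    omega
  rw [List.getD_eq_getElem _ _ h]
  simp only [packed, List.getElem_map, List.getElem_range]
  rw [show (8 * i + q) % 8 = q by omega, show (8 * i + q) / 8 = i by omega]

/-- The mathematical contents of the data structure. The range minima of `A` are to be found
between the positions of two vertices; `s` and `t` are the numbers of the source and the sink. -/
structure Tables where
  /-- the position of a vertex -/
  pos : ℕ → ℕ
  /-- the sequence whose range minima are queried -/
  A : ℕ → ℝ
  /-- an upper bound of the sequence -/
  M : ℝ
  s : ℕ
  t : ℕ
  /-- the least capacity of a cut that does not contain a vertex other than the source -/
  avoid : ℕ → ℝ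
  /-- the least capacity of a cut that contains a vertex other than the sink -/
  hit : ℕ → ℝ
  /-- the capacity of an `(s,t)`-mincut -/
  least : ℝ

variable (τ : Tables)

open Classical in
/-- The words stored with the number `i`. Positions are divided into blocks of length `B`. If `i`
is a vertex, the entries `0`, `1`, `2`, `3` are its position, the number and the start of its block,
and the mask of prefix minima from its position; entry `4` is the binary logarithm of `i`; the
entries `5` and `6` mark the source and the sink. -/
noncomputable def Tables.word (B : ℕ) (q i : ℕ) : ℕ :=
  match q with
  | 0 => τ.pos i
  | 1 => τ.pos i / B
  | 2 => τ.pos i / B * B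
  | 3 => prefixMinMask τ.A B (τ.pos i)
  | 4 => i.log2
  | 5 => if i = τ.s then 1 else 0
  | 6 => if i = τ.t then 1 else 0
  | _ => 0

/-- The reals stored with the number `i`: the sequence itself; for a vertex the minima from its
position to the end of its block and from the start of its block to its position; for
`i = b * B + k` with `k < B` the minima from the end of block `b` to the next multiple of `2 ^ k`
blocks, and from the last multiple of `2 ^ k` blocks to the start of block `b`. -/
noncomputable def Tables.real (B : ℕ) (q i : ℕ) : ℝ :=
  match q with
  | 0 => τ.A i
  | 1 => rangeMin τ.A τ.M (τ.pos i) ((τ.pos i / B + 1) * B)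
  | 2 => rangeMin τ.A τ.M (τ.pos i / B * B) (τ.pos i)
  | 3 => rangeMin τ.A τ.M ((i / B + 1) * B) ((i / B / 2 ^ (i % B) + 1) * 2 ^ (i % B) * B)
  | 4 => rangeMin τ.A τ.M (i / B / 2 ^ (i % B) * 2 ^ (i % B) * B) (i / B * B)
  | 5 => τ.avoid i
  | 6 => τ.hit i
  | _ => τ.least

/-- The memory image of the tables, with `N` groups of eight words and of eight reals. -/
noncomputable def Tables.data (B N : ℕ) : Data :=
  ⟨packed N (τ.word B), packed N (τ.real B)⟩

/-- The requirements on the word length `w`, the block length `B` and the number `N` of groups, for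
`n` vertices. -/
structure Dims (w n B N : ℕ) : Prop where
  B_pos : 0 < B
  lt_pow : n < 2 ^ B
  pow_le : 2 ^ B ≤ N
  add_le : n + B ≤ N
  le_word : 8 * N ≤ 2 ^ w

variable {τ} {n B N : ℕ}

theorem Tables.words_getD {i q : ℕ} (hi : i < N) (hq : q < 8) :
    (τ.data B N).words.getD (8 * i + q) 0 = τ.word B q i := packed_getD hi hq 0

theorem Tables.reals_getD {i q : ℕ} (hi : i < N) (hq : q < 8) :
    (τ.data B N).reals.getD (8 * i + q) 0 = τ.real B q i := packed_getD hi hq 0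

/-- The minimum over a range that meets two blocks, from four table entries. -/
theorem rangeMin_of_blocks {A : ℕ → ℝ} {M : ℝ} {i j bi bj e : ℕ} (hB : 0 < B)
    (hbi : bi = i / B) (hbj : bj = j / B) (hlt : bi < bj) (he : e = (bi ^^^ bj).log2) :
    min (min (min (rangeMin A M ((bi + 1) * B) ((bi / 2 ^ e + 1) * 2 ^ e * B))
      (rangeMin A M (bj / 2 ^ e * 2 ^ e * B) (bj * B)))
      (rangeMin A M (bj * B) j)) (rangeMin A M i ((bi + 1) * B)) = rangeMin A M i j := by
  have hdiv := div_eq_succ_div_of_log2_xor hlt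
  rw [← he] at hdiv
  have h1 : bi + 1 ≤ (bi / 2 ^ e + 1) * 2 ^ e := Nat.lt_mul_of_div_lt (by omega) (by positivity)
  have h2 : bj / 2 ^ e * 2 ^ e ≤ bj := Nat.div_mul_le_self _ _
  have h3 : bj * B ≤ j := hbj ▸ Nat.div_mul_le_self _ _
  have h4 : i ≤ (bi + 1) * B := (Nat.lt_mul_of_div_lt (by omega) hB).le
  rw [hdiv] at h2 ⊢
  rw [min_rangeMin (Nat.mul_le_mul_right _ h1) (Nat.mul_le_mul_right _ h2),
    min_rangeMin (Nat.mul_le_mul_right _ hlt) h3, min_comm, min_rangeMin h4]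
  exact (Nat.mul_le_mul_right _ hlt).trans h3

/-! ### The programs -/

/-- The common part of both programs. With vertex numbers in the word registers `0` and `1`, it puts
`0`, `1` or `2` into the word register `0`, if the position of the first vertex is equal to, less
than or greater than that of the second one, and in the last two cases the range minimum between the
two positions into the real register `1`.

From instruction `18` on, the word registers `3`, `4` hold the eightfold of the vertices in the order
of their positions, and `5`, `6` these positions. -/
def core : Program :=
  [.const 2 8,
   .const 7 1,
   .word .mul 3 0 2,
   .word .mul 4 1 2,
   .loadWord 5 3,
   .loadWord 6 4,
   .jumpLt 5 6 14,
   .jumpEq 5 6 16,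
   .word .mul 3 1 2,
   .word .mul 4 0 2,
   .loadWord 5 3,
   .loadWord 6 4,
   .const 0 2,
   .jumpEq 0 0 18,
   .const 0 1,
   .jumpEq 0 0 18,
   .const 0 0,
   .jumpEq 0 0 66,
   -- 18: the blocks of the two positions
   .word .add 10 3 7,
   .loadWord 10 10,
   .word .add 11 4 7,
   .loadWord 11 11,
   .jumpEq 10 11 53,
   -- 23: different blocks; the level is the most significant bit in which they differ
   .word .xor 12 10 11,
   .word .mul 12 12 2,
   .const 13 4,
   .word .add 12 12 13,
   .loadWord 12 12,
   .const 13 2,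
   .word .add 14 3 13,
   .loadWord 15 14,
   .word .add 15 15 12,
   .word .mul 15 15 2,
   .const 16 3,
   .word .add 15 15 16,
   .loadReal 1 15,
   .word .add 14 4 13,
   .loadWord 15 14,
   .word .add 15 15 12,
   .word .mul 15 15 2,
   .const 16 4,
   .word .add 15 15 16,
   .loadReal 2 15,
   .loadReal 3 14,
   .word .add 14 3 7,
   .loadReal 4 14,
   .jumpLtReal 1 2 48,
   .addReal 1 2 9,
   .jumpLtReal 1 3 50,
   .addReal 1 3 9,
   .jumpLtReal 1 4 52,
   .addReal 1 4 9,
   .jumpEq 0 0 66,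
   -- 53: the same block; the last prefix minimum in the range is the most significant bit
   -- of the truncated mask
   .const 13 3,
   .word .add 14 3 13,
   .loadWord 12 14,
   .word .sub 15 6 5,
   .word .shl 16 7 15,
   .word .mod 12 12 16,
   .word .mul 12 12 2,
   .const 13 4,
   .word .add 12 12 13,
   .loadWord 12 12,
   .word .add 12 12 5,
   .word .mul 12 12 2,
   .loadReal 1 12]

/-- The program for the positions of two vertices below their lowest common ancestor and the
capacity stored there. -/
def locate : Program := core ++ [.addReal 0 1 9]

/-- The program for the mincut capacity after the change `Δ`, given in the real register `0`, of the
capacity of an edge. -/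
def capacity : Program := core ++
  [.const 13 7,
   .loadReal 4 13,
   .jumpEq 0 7 71,
   -- 69: the first endpoint is not to the left of the second one
   .addReal 0 4 9,
   .jumpEq 0 0 86,
   -- 71: the mincut capacity of the edge after the change
   .addReal 0 0 1,
   .const 13 5,
   .word .add 14 3 13,
   .loadWord 15 14,
   .jumpEq 15 7 79,
   -- 76: cuts that avoid the first endpoint
   .loadReal 4 14,
   .jumpLtReal 0 4 79,
   .addReal 0 4 9,
   -- 79
   .const 13 6,
   .word .add 14 4 13,
   .loadWord 15 14,
   .jumpEq 15 7 86,
   .loadReal 4 14,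
   .jumpLtReal 0 4 86,
   .addReal 0 4 9]

end CapRAM

/-! ### Correctness of the programs -/

namespace CapRAM

variable {τ : Tables} {w n B N : ℕ} {Q : State → Prop}

/-- The result of the part of `core` that starts at instruction `18`. -/
def RangeFound (wr : ℕ → ℕ) (rr : ℕ → ℝ) (c : ℝ) (σ : State) : Prop :=
  σ.pc = 66 ∧ (∀ i ∈ [0, 2, 3, 4, 7], σ.wreg i = wr i) ∧
    σ.rreg 0 = rr 0 ∧ σ.rreg 1 = c ∧ σ.rreg 9 = 0

theorem reaches_of_blocks_ne (tail : Program) (hd : Dims w n B N) {u v k : ℕ} {wr : ℕ → ℕ}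
    {rr : ℕ → ℝ} (hu : u < n) (hv : v < n) (hpv : τ.pos v < n)
    (hlt : τ.pos u < τ.pos v) (h2 : wr 2 = 8) (h3 : wr 3 = 8 * u) (h4 : wr 4 = 8 * v)
    (h7 : wr 7 = 1) (h10 : wr 10 = τ.pos u / B) (h11 : wr 11 = τ.pos v / B)
    (hne : wr 10 ≠ wr 11) (h9 : rr 9 = 0) :
    Reaches w (τ.data B N) (core ++ tail) (k + 30) ⟨23, wr, rr⟩
      (RangeFound wr rr (rangeMin τ.A τ.M (τ.pos u) (τ.pos v))) := by
  obtain ⟨hB, hn, hpow, hadd, hw⟩ := hd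
  set i := τ.pos u with hi
  set j := τ.pos v with hj
  have hbi : i / B ≤ i := Nat.div_le_self _ _
  have hbj : j / B ≤ j := Nat.div_le_self _ _
  have hblt : i / B < j / B := lt_of_le_of_ne (Nat.div_le_div_right hlt.le) (by rwa [← h10, ← h11])
  have hsi : i / B * B ≤ i := Nat.div_mul_le_self _ _
  have hsj : j / B * B ≤ j := Nat.div_mul_le_self _ _
  set x := (i / B) ^^^ (j / B) with hx
  have hxlt : x < 2 ^ B := Nat.xor_lt_two_pow (by omega) (by omega)
  have hx0 : x ≠ 0 := by
    rw [hx, Ne, Nat.xor_eq_zero_iff]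
    omega
  have hk : x.log2 < B := (Nat.log2_lt hx0).2 hxlt
  set e := x.log2 with he
  have hdi : (i / B * B + e) / B = i / B := by
    rw [mul_comm, Nat.mul_add_div hB, Nat.div_eq_of_lt hk, add_zero]
  have hdj : (j / B * B + e) / B = j / B := by
    rw [mul_comm, Nat.mul_add_div hB, Nat.div_eq_of_lt hk, add_zero]
  have hmi : (i / B * B + e) % B = e := by
    rw [mul_comm, Nat.mul_add_mod, Nat.mod_eq_of_lt hk]
  have hmj : (j / B * B + e) % B = e := by
    rw [mul_comm, Nat.mul_add_mod, Nat.mod_eq_of_lt hk]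
  refine reaches_word rfl x h10 h11 rfl ?_
  refine reaches_word (x := x) (y := 8) rfl (8 * x) (by simp) (by simp [h2])
    (eval_mul_eight (by omega)) ?_
  refine reaches_const rfl (by omega) ?_
  refine reaches_word (x := 8 * x) (y := 4) rfl (8 * x + 4) (by simp) (by simp)
    (eval_add (by omega)) ?_
  refine reaches_loadWord (x := 8 * x + 4) rfl e (by simp)
    (Tables.words_getD (by omega) (by omega)) ?_
  refine reaches_const rfl (by omega) ?_
  refine reaches_word (x := 8 * u) (y := 2) rfl (8 * u + 2) (by simp [h3]) (by simp)
    (eval_add (by omega)) ?_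
  refine reaches_loadWord (x := 8 * u + 2) rfl (i / B * B) (by simp)
    (Tables.words_getD (by omega) (by omega)) ?_
  refine reaches_word (x := i / B * B) (y := e) rfl (i / B * B + e) (by simp) (by simp)
    (eval_add (by omega)) ?_
  refine reaches_word (x := i / B * B + e) (y := 8) rfl (8 * (i / B * B + e)) (by simp)
    (by simp [h2]) (eval_mul_eight (by omega)) ?_
  refine reaches_const rfl (by omega) ?_
  refine reaches_word (x := 8 * (i / B * B + e)) (y := 3) rfl (8 * (i / B * B + e) + 3) (by simp)
    (by simp) (eval_add (by omega)) ?_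
  refine reaches_loadReal (x := 8 * (i / B * B + e) + 3) rfl
    (rangeMin τ.A τ.M ((i / B + 1) * B) ((i / B / 2 ^ e + 1) * 2 ^ e * B)) (by simp)
    ((Tables.reals_getD (by omega) (by omega)).trans (by simp only [Tables.real, hdi, hmi])) ?_
  refine reaches_word (x := 8 * v) (y := 2) rfl (8 * v + 2) (by simp [h4]) (by simp)
    (eval_add (by omega)) ?_
  refine reaches_loadWord (x := 8 * v + 2) rfl (j / B * B) (by simp)
    (Tables.words_getD (by omega) (by omega)) ?_
  refine reaches_word (x := j / B * B) (y := e) rfl (j / B * B + e) (by simp) (by simp)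
    (eval_add (by omega)) ?_
  refine reaches_word (x := j / B * B + e) (y := 8) rfl (8 * (j / B * B + e)) (by simp)
    (by simp [h2]) (eval_mul_eight (by omega)) ?_
  refine reaches_const rfl (by omega) ?_
  refine reaches_word (x := 8 * (j / B * B + e)) (y := 4) rfl (8 * (j / B * B + e) + 4) (by simp)
    (by simp) (eval_add (by omega)) ?_
  refine reaches_loadReal (x := 8 * (j / B * B + e) + 4) rfl
    (rangeMin τ.A τ.M (j / B / 2 ^ e * 2 ^ e * B) (j / B * B)) (by simp)
    ((Tables.reals_getD (by omega) (by omega)).trans (by simp only [Tables.real, hdj, hmj])) ?_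
  refine reaches_loadReal (x := 8 * v + 2) rfl (rangeMin τ.A τ.M (j / B * B) j) (by simp)
    (Tables.reals_getD (by omega) (by omega)) ?_
  refine reaches_word (x := 8 * u) (y := 1) rfl (8 * u + 1) (by simp [h3]) (by simp [h7])
    (eval_add (by omega)) ?_
  refine reaches_loadReal (x := 8 * u + 1) rfl (rangeMin τ.A τ.M i ((i / B + 1) * B)) (by simp)
    (Tables.reals_getD (by omega) (by omega)) ?_
  refine reaches_min rfl rfl rfl _ _ (by simp; rfl) (by simp; rfl) (by simp [h9]) ?_
  refine reaches_min rfl rfl rfl _ _ (by simp; rfl) (by simp; rfl) (by simp [h9]) ?_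
  refine reaches_min rfl rfl rfl _ _ (by simp; rfl) (by simp; rfl) (by simp [h9]) ?_
  rw [rangeMin_of_blocks hB rfl rfl hblt he]
  refine reaches_jumpEq rfl (fun _ => .done ?_) (fun h => absurd rfl h)
  exact ⟨rfl, by simp, by simp, by simp, by simp [h9]⟩

theorem reaches_of_blocks_eq (tail : Program) (hd : Dims w n B N) (hM : ∀ i, τ.A i ≤ τ.M)
    {u v k : ℕ} {wr : ℕ → ℕ}
    {rr : ℕ → ℝ} (hu : u < n) (hpv : τ.pos v < n)
    (hlt : τ.pos u < τ.pos v) (h2 : wr 2 = 8) (h3 : wr 3 = 8 * u) (h5 : wr 5 = τ.pos u)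
    (h6 : wr 6 = τ.pos v)
    (h7 : wr 7 = 1) (heq : τ.pos u / B = τ.pos v / B) (h9 : rr 9 = 0) :
    Reaches w (τ.data B N) (core ++ tail) (k + 13) ⟨53, wr, rr⟩
      (RangeFound wr rr (rangeMin τ.A τ.M (τ.pos u) (τ.pos v))) := by
  obtain ⟨hB, hn, hpow, hadd, hw⟩ := hd
  set i := τ.pos u with hi
  set j := τ.pos v with hj
  have hlen : j - i ≤ B := by
    have h1 := Nat.div_add_mod i B
    have h2 := Nat.div_add_mod j B
    have h3 := Nat.mod_lt j hB
    rw [heq] at h1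
    omega
  set m := prefixMinMask τ.A B i with hm
  have hm' : m < 2 ^ B := prefixMinMask_lt _ _ _
  obtain ⟨hlog, hmin⟩ := rangeMin_of_prefixMinMask (A := τ.A) (M := τ.M) (B := B) hlt (by omega)
    fun k _ _ => hM k
  have hpl : 2 ^ (j - i) ≤ 2 ^ B := Nat.pow_le_pow_right (by omega) hlen
  have hmm : m % 2 ^ (j - i) ≤ m := Nat.mod_le _ _
  rw [← hm] at hlog hmin
  set q := m % 2 ^ (j - i) with hq
  rw [hmin]
  refine reaches_const rfl (by omega) ?_
  refine reaches_word (x := 8 * u) (y := 3) rfl (8 * u + 3) (by simp [h3]) (by simp)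
    (eval_add (by omega)) ?_
  refine reaches_loadWord (x := 8 * u + 3) rfl m (by simp)
    (Tables.words_getD (by omega) (by omega)) ?_
  refine reaches_word (x := j) (y := i) rfl (j - i) (by simp [h6]) (by simp [h5])
    (eval_sub (by omega) (by omega)) ?_
  refine reaches_word (x := 1) (y := j - i) rfl (2 ^ (j - i)) (by simp [h7]) (by simp)
    (eval_one_shl (by omega)) ?_
  refine reaches_word (x := m) (y := 2 ^ (j - i)) rfl q (by simp) (by simp) rfl ?_
  refine reaches_word (x := q) (y := 8) rfl (8 * q) (by simp) (by simp [h2])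
    (eval_mul_eight (by omega)) ?_
  refine reaches_const rfl (by omega) ?_
  refine reaches_word (x := 8 * q) (y := 4) rfl (8 * q + 4) (by simp) (by simp)
    (eval_add (by omega)) ?_
  refine reaches_loadWord (x := 8 * q + 4) rfl q.log2 (by simp)
    (Tables.words_getD (by omega) (by omega)) ?_
  refine reaches_word (x := q.log2) (y := i) rfl (i + q.log2) (by simp) (by simp [h5])
    ((eval_add (by omega)).trans (add_comm _ _)) ?_
  refine reaches_word (x := i + q.log2) (y := 8) rfl (8 * (i + q.log2)) (by simp) (by simp [h2])
    (eval_mul_eight (by omega)) ?_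
  refine reaches_loadReal (x := 8 * (i + q.log2) + 0) rfl (τ.A (i + q.log2)) (by simp)
    (Tables.reals_getD (by omega) (by omega)) (.done ?_)
  exact ⟨rfl, by simp, by simp, by simp, by simp [h9]⟩

theorem reaches_rangeMin (tail : Program) (hd : Dims w n B N) (hM : ∀ i, τ.A i ≤ τ.M)
    {u v : ℕ} {wr : ℕ → ℕ} {rr : ℕ → ℝ} (hu : u < n) (hv : v < n)
    (hpv : τ.pos v < n) (hlt : τ.pos u < τ.pos v) (h2 : wr 2 = 8) (h3 : wr 3 = 8 * u)
    (h4 : wr 4 = 8 * v) (h5 : wr 5 = τ.pos u) (h6 : wr 6 = τ.pos v) (h7 : wr 7 = 1)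
    (h9 : rr 9 = 0) :
    Reaches w (τ.data B N) (core ++ tail) 35 ⟨18, wr, rr⟩
      (RangeFound wr rr (rangeMin τ.A τ.M (τ.pos u) (τ.pos v))) := by
  have hd' := hd
  obtain ⟨hB, hn, hpow, hadd, hw⟩ := hd'
  have hkeep : ∀ wr', (∀ i ∈ [0, 2, 3, 4, 7], wr' i = wr i) → ∀ c σ, RangeFound wr' rr c σ →
      RangeFound wr rr c σ := fun wr' h c σ hσ =>
    ⟨hσ.1, fun i hi => (hσ.2.1 i hi).trans (h i hi), hσ.2.2⟩
  refine reaches_word (x := 8 * u) (y := 1) rfl (8 * u + 1) h3 h7 (eval_add (by omega)) ?_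
  refine reaches_loadWord (x := 8 * u + 1) rfl (τ.pos u / B) (by simp)
    (Tables.words_getD (by omega) (by omega)) ?_
  refine reaches_word (x := 8 * v) (y := 1) rfl (8 * v + 1) (by simp [h4]) (by simp [h7])
    (eval_add (by omega)) ?_
  refine reaches_loadWord (x := 8 * v + 1) rfl (τ.pos v / B) (by simp)
    (Tables.words_getD (by omega) (by omega)) ?_
  refine reaches_jumpEq rfl (fun h => ?_) (fun h => ?_)
  · refine (reaches_of_blocks_eq (k := 17) tail hd hM (v := v) hu hpv hlt (by simp [h2])
      (by simp [h3]) (by simp [h5]) (by simp [h6]) (by simp [h7]) (by simpa using h) h9).trans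
      (k' := 0) fun σ hσ => .done (hkeep _ (by simp) _ _ hσ)
  · refine (reaches_of_blocks_ne (k := 0) tail hd (v := v) hu hv hpv hlt (by simp [h2])
      (by simp [h3]) (by simp [h4]) (by simp [h7]) (by simp) (by simp) h h9).trans
      (k' := 0) fun σ hσ => .done (hkeep _ (by simp) _ _ hσ)

/-- The result of `core` for the vertices `u` and `v`. -/
def Located (τ : Tables) (u v : ℕ) (x : ℝ) (σ : State) : Prop :=
  σ.pc = 66 ∧ σ.rreg 0 = x ∧ σ.rreg 9 = 0 ∧ σ.wreg 7 = 1 ∧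
    ((τ.pos u = τ.pos v ∧ σ.wreg 0 = 0) ∨
     (τ.pos u < τ.pos v ∧ σ.wreg 0 = 1 ∧ σ.wreg 3 = 8 * u ∧ σ.wreg 4 = 8 * v ∧
        σ.rreg 1 = rangeMin τ.A τ.M (τ.pos u) (τ.pos v)) ∨
     (τ.pos v < τ.pos u ∧ σ.wreg 0 = 2 ∧ σ.rreg 1 = rangeMin τ.A τ.M (τ.pos v) (τ.pos u)))

theorem reaches_located (tail : Program) (hd : Dims w n B N) (hM : ∀ i, τ.A i ≤ τ.M)
    (hpos : ∀ u < n, τ.pos u < n) {u v : ℕ} (x : ℝ) (hu : u < n) (hv : v < n) :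
    Reaches w (τ.data B N) (core ++ tail) 49 (start u v x) (Located τ u v x) := by
  have hd' := hd
  obtain ⟨hB, hn, hpow, hadd, hw⟩ := hd'
  have hpu := hpos u hu
  have hpv := hpos v hv
  refine reaches_const rfl (by omega) ?_
  refine reaches_const rfl (by omega) ?_
  refine reaches_word (x := u) (y := 8) rfl (8 * u) (by simp) (by simp)
    (eval_mul_eight (by omega)) ?_
  refine reaches_word (x := v) (y := 8) rfl (8 * v) (by simp) (by simp)
    (eval_mul_eight (by omega)) ?_
  refine reaches_loadWord (x := 8 * u + 0) rfl (τ.pos u) (by simp)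
    (Tables.words_getD (by omega) (by omega)) ?_
  refine reaches_loadWord (x := 8 * v + 0) rfl (τ.pos v) (by simp)
    (Tables.words_getD (by omega) (by omega)) ?_
  refine reaches_jumpLt rfl (fun h => ?_) (fun h => reaches_jumpEq rfl (fun h' => ?_) fun h' => ?_)
  · have hlt : τ.pos u < τ.pos v := by simpa using h
    refine reaches_const rfl (by omega) ?_
    refine reaches_jumpEq (k := 40) rfl (fun _ => ?_) (fun h => absurd rfl h)
    refine (reaches_rangeMin tail hd hM hu hv hpv hlt (by simp) (by simp) (by simp) (by simp)
      (by simp) (by simp) (by simp)).trans (k' := 5) fun σ hσ => .done ?_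
    obtain ⟨g1, g2, g3, g4, g5⟩ := hσ
    exact ⟨g1, by simpa using g3, g5, by simpa using g2 7 (by simp), .inr (.inl ⟨hlt,
      by simpa using g2 0 (by simp), by simpa using g2 3 (by simp), by simpa using g2 4 (by simp),
      g4⟩)⟩
  · refine reaches_const rfl (by omega) ?_
    refine reaches_jumpEq (k := 39) rfl (fun _ => .done ?_) (fun h => absurd rfl h)
    exact ⟨rfl, by simp, by simp, by simp, .inl ⟨by simpa using h', by simp⟩⟩
  · have hlt : τ.pos v < τ.pos u := by
      have h1 : ¬ τ.pos u < τ.pos v := by simpa using h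
      have h2 : ¬ τ.pos u = τ.pos v := by simpa using h'
      omega
    refine reaches_word (x := v) (y := 8) rfl (8 * v) (by simp) (by simp)
      (eval_mul_eight (by omega)) ?_
    refine reaches_word (x := u) (y := 8) rfl (8 * u) (by simp) (by simp)
      (eval_mul_eight (by omega)) ?_
    refine reaches_loadWord (x := 8 * v + 0) rfl (τ.pos v) (by simp)
      (Tables.words_getD (by omega) (by omega)) ?_
    refine reaches_loadWord (x := 8 * u + 0) rfl (τ.pos u) (by simp)
      (Tables.words_getD (by omega) (by omega)) ?_
    refine reaches_const rfl (by omega) ?_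
    refine reaches_jumpEq (k := 35) rfl (fun _ => ?_) (fun h => absurd rfl h)
    refine (reaches_rangeMin tail hd hM hv hu hpu hlt (by simp) (by simp) (by simp) (by simp)
      (by simp) (by simp) (by simp)).trans (k' := 0) fun σ hσ => .done ?_
    obtain ⟨g1, g2, g3, g4, g5⟩ := hσ
    exact ⟨g1, by simpa using g3, g5, by simpa using g2 7 (by simp), .inr (.inr ⟨hlt,
      by simpa using g2 0 (by simp), g4⟩)⟩

theorem answers_locate (hd : Dims w n B N) (hM : ∀ i, τ.A i ≤ τ.M)
    (hpos : ∀ u < n, τ.pos u < n) {u v : ℕ} (hu : u < n) (hv : v < n) :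
    Answers w (τ.data B N) locate 70 u v 0 fun σ =>
      (τ.pos u = τ.pos v ∧ σ.wreg 0 = 0) ∨
      (τ.pos u < τ.pos v ∧ σ.wreg 0 = 1 ∧ σ.rreg 0 = rangeMin τ.A τ.M (τ.pos u) (τ.pos v)) ∨
      (τ.pos v < τ.pos u ∧ σ.wreg 0 = 2 ∧ σ.rreg 0 = rangeMin τ.A τ.M (τ.pos v) (τ.pos u)) := by
  refine Reaches.answers ?_
  refine (reaches_located _ hd hM hpos 0 hu hv).trans (k' := 20 + 1) ?_
  rintro ⟨pc, wr, rr⟩ ⟨rfl, -, h9, -, h⟩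
  refine reaches_addReal rfl (rr 1) (by simpa using h9) (.done ⟨le_rfl, ?_⟩)
  rcases h with h | ⟨h1, h2, -, -, h3⟩ | ⟨h1, h2, h3⟩
  · exact .inl h
  · exact .inr (.inl ⟨h1, h2, by simpa using h3⟩)
  · exact .inr (.inr ⟨h1, h2, by simpa using h3⟩)

open Classical in
/-- The result of the program `capacity`. -/
noncomputable def Tables.updated (τ : Tables) (u v : ℕ) (x : ℝ) : ℝ :=
  if τ.pos u < τ.pos v then
    let c := x + rangeMin τ.A τ.M (τ.pos u) (τ.pos v)
    let c' := if u = τ.s then c else min c (τ.avoid u)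
    if v = τ.t then c' else min c' (τ.hit v)
  else τ.least

theorem answers_capacity (hd : Dims w n B N) (hM : ∀ i, τ.A i ≤ τ.M)
    (hpos : ∀ u < n, τ.pos u < n) {u v : ℕ} (x : ℝ) (hu : u < n) (hv : v < n) :
    Answers w (τ.data B N) capacity 70 u v x fun σ => σ.rreg 0 = τ.updated u v x := by
  refine Reaches.answers ?_
  refine (reaches_located _ hd hM hpos x hu hv).trans (k' := 20 + 1) ?_
  obtain ⟨hB, hn, hpow, hadd, hw⟩ := hd
  rintro ⟨pc, wr, rr⟩ ⟨rfl, h0, h9, h7, h⟩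
  dsimp only at h0 h9 h7 h
  refine reaches_const rfl (by omega) ?_
  refine reaches_loadReal (x := 8 * 0 + 7) rfl τ.least (by simp)
    (Tables.reals_getD (by omega) (by omega)) ?_
  have hfalse : ¬ τ.pos u < τ.pos v → wr 0 ≠ 1 := by
    rcases h with ⟨h1, h2⟩ | ⟨h1, h2, -⟩ | ⟨h1, h2, -⟩ <;> intro <;> omega
  refine reaches_jumpEq rfl (fun h1 => ?_) (fun h1 => ?_)
  · have hlt : τ.pos u < τ.pos v := by
      by_contra hlt
      exact hfalse hlt (by simpa [h7] using h1)
    obtain ⟨-, -, h3, h4, hr⟩ := (h.resolve_left (by omega)).resolve_right (by omega)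
    set c := x + rangeMin τ.A τ.M (τ.pos u) (τ.pos v) with hc
    set c' := if u = τ.s then c else min c (τ.avoid u) with hc'
    have hup : τ.updated u v x = if v = τ.t then c' else min c' (τ.hit v) := by
      simp only [Tables.updated, if_pos hlt, hc', hc]
    refine reaches_addReal rfl c (by simp [h0, hr, hc]) ?_
    refine reaches_const rfl (by omega) ?_
    refine reaches_word (x := 8 * u) (y := 5) rfl (8 * u + 5) (by simp [h3]) (by simp)
      (eval_add (by omega)) ?_
    refine reaches_loadWord (x := 8 * u + 5) rfl (if u = τ.s then 1 else 0) (by simp)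
      (Tables.words_getD (by omega) (by omega)) ?_
    -- both ways to instruction `79` leave `c'` in the real register `0`
    have hnext : ∀ wr' rr', wr' 4 = 8 * v → wr' 7 = 1 → rr' 0 = c' → rr' 9 = 0 →
        Reaches w (τ.data B N) capacity 8 ⟨79, wr', rr'⟩
          fun σ => capacity.length ≤ σ.pc ∧ σ.rreg 0 = τ.updated u v x := by
      intro wr' rr' g4 g7 g0 g9
      refine reaches_const rfl (by omega) ?_
      refine reaches_word (x := 8 * v) (y := 6) rfl (8 * v + 6) (by simp [g4]) (by simp)
        (eval_add (by omega)) ?_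
      refine reaches_loadWord (x := 8 * v + 6) rfl (if v = τ.t then 1 else 0) (by simp)
        (Tables.words_getD (by omega) (by omega)) ?_
      rw [hup]
      refine reaches_jumpEq rfl (fun g => .done ⟨le_rfl, ?_⟩) (fun g => ?_)
      · have : v = τ.t := by simpa [g7] using g
        simp [this, g0]
      · have : v ≠ τ.t := by simpa [g7] using g
        refine reaches_loadReal (x := 8 * v + 6) rfl (τ.hit v) (by simp)
          (Tables.reals_getD (by omega) (by omega)) ?_
        refine reaches_min rfl rfl rfl c' (τ.hit v) (by simp [g0]) (by simp) (by simp [g9])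
          (.done ⟨le_rfl, ?_⟩)
        simp [this]
    refine reaches_jumpEq rfl (fun g => ?_) (fun g => ?_)
    · have hs : u = τ.s := by simpa [h7] using g
      exact (hnext _ _ (by simp [h4]) (by simp [h7]) (by simp [hc', hs]) (by simp [h9])).mono
        (by omega)
    · have hs : u ≠ τ.s := by simpa [h7] using g
      refine reaches_loadReal (x := 8 * u + 5) rfl (τ.avoid u) (by simp)
        (Tables.reals_getD (by omega) (by omega)) ?_
      refine reaches_min rfl rfl rfl c (τ.avoid u) (by simp) (by simp) (by simp [h9]) ?_
      exact (hnext _ _ (by simp [h4]) (by simp [h7]) (by simp [hc', hs]) (by simp [h9])).mono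
        (by omega)
  · have hge : ¬ τ.pos u < τ.pos v := by
      intro hlt
      obtain ⟨-, h2, -⟩ := (h.resolve_left (by omega)).resolve_right (by omega)
      exact h1 (by simp [h2, h7])
    refine reaches_addReal rfl τ.least (by simp [h9]) ?_
    refine reaches_jumpEq rfl (fun _ => .done ⟨le_rfl, ?_⟩) (fun h => absurd rfl h)
    simp [Tables.updated, hge]

theorem Tables.size_data (τ : Tables) (B N : ℕ) : (τ.data B N).size = 16 * N := by
  simp only [Data.size, Tables.data, packed, List.length_map, List.length_range]
  omega

theorem Tables.fitsWords_data (hd : Dims w n B N) (hpos : ∀ u, τ.pos u < n) :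
    (τ.data B N).FitsWords w := by
  obtain ⟨hB, hn, hpow, hadd, hw⟩ := hd
  intro x hx
  simp only [Tables.data, packed, List.mem_map, List.mem_range] at hx
  obtain ⟨a, ha, rfl⟩ := hx
  have hp := hpos (a / 8)
  have h1 : τ.pos (a / 8) / B ≤ τ.pos (a / 8) := Nat.div_le_self _ _
  have h2 : τ.pos (a / 8) / B * B ≤ τ.pos (a / 8) := Nat.div_mul_le_self _ _
  have h3 : prefixMinMask τ.A B (τ.pos (a / 8)) < 2 ^ B := prefixMinMask_lt _ _ _
  have h4 : Nat.log2 (a / 8) ≤ a / 8 := by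
    rw [Nat.log2_eq_log_two]
    exact Nat.log_le_self _ _
  unfold Tables.word
  split <;> first | omega | (split_ifs <;> omega)

end CapRAM

/-! ### The data structure of a tree -/

namespace CapRAM

variable {n : ℕ}

/-- The tables for a graph on `Fin n` and a tree: positions are leaf numbers and the sequence
consists of the stored capacities in symmetric order. -/
noncomputable def treeTables (G : STGraph (Fin n)) (T : CapTree (Fin n)) (M : ℝ)
    (a b : Fin n → ℝ) : Tables where
  pos i := if h : i < n then T.leafIdx ⟨i, h⟩ else 0
  A i := T.caps.getD i 0
  M := M
  s := G.source
  t := G.sink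
  avoid i := if h : i < n then a ⟨i, h⟩ else 0
  hit i := if h : i < n then b ⟨i, h⟩ else 0
  least := G.minCutCapacity

variable {G : STGraph (Fin n)} {T : CapTree (Fin n)} {M : ℝ} {a b : Fin n → ℝ}

@[simp]
theorem treeTables_pos (u : Fin n) : (treeTables G T M a b).pos u = T.leafIdx u := by
  simp [treeTables]

theorem treeTables_pos_lt (hn : 0 < n) (hT : T.numNodes < 2 * n) (i : ℕ) :
    (treeTables G T M a b).pos i < n := by
  have hlen := T.numNodes_eq
  simp only [treeTables]
  split_ifs with h
  · have := T.leafIdx_le ⟨i, h⟩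
    omega
  · exact hn

theorem rangeMin_treeTables (hM : ∀ i, T.caps.getD i 0 ≤ M) {i j : ℕ} {c : ℝ}
    (h : IsLeastBetween T.caps i j c) :
    rangeMin (treeTables G T M a b).A (treeTables G T M a b).M i j = c := by
  obtain ⟨⟨k, h1, h2, rfl⟩, h3⟩ := h
  exact rangeMin_eq (A := (treeTables G T M a b).A) h1 h2 (hM k) h3

/-- The value computed from the tables is the new mincut capacity. The capacity of the edge is not
needed: for a non-vital edge whose first endpoint lies to the left of the second one, the cuts to
which the edge does not contribute decide. -/
theorem updated_treeTables (hpos : ∀ e ∈ G.edges, 0 < G.cap e) (hT : IsVitTree G Finset.univ T)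
    (hM : ∀ i, T.caps.getD i 0 ≤ M)
    (ha : ∀ u, u ≠ G.source → (∃ C, G.IsCut C ∧ u ∉ C ∧ a u = G.cutCapacity C) ∧
      ∀ C, G.IsCut C → u ∉ C → a u ≤ G.cutCapacity C)
    (hb : ∀ v, v ≠ G.sink → (∃ C, G.IsCut C ∧ v ∈ C ∧ b v = G.cutCapacity C) ∧
      ∀ C, G.IsCut C → v ∈ C → b v ≤ G.cutCapacity C)
    {e : Fin n × Fin n} (he : e ∈ G.edges) {x : ℝ} (hx : -G.cap e ≤ x) :
    (treeTables G T M a b).updated e.1 e.2 x =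
      (G.setCapacity e (G.cap e + x)).minCutCapacity := by
  have hs : ((e.1 : ℕ) = (treeTables G T M a b).s) ↔ e.1 = G.source := Fin.val_inj
  have ht : ((e.2 : ℕ) = (treeTables G T M a b).t) ↔ e.2 = G.sink := Fin.val_inj
  have ha' : (treeTables G T M a b).avoid e.1 = a e.1 := by simp [treeTables]
  have hb' : (treeTables G T M a b).hit e.2 = b e.2 := by simp [treeTables]
  simp only [Tables.updated, treeTables_pos, hs, ht, ha', hb']
  by_cases hlt : T.leafIdx e.1 < T.leafIdx e.2
  swap
  · rw [if_neg hlt]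
    refine (STGraph.minCutCapacity_setCapacity_of_not_isVital hpos he (fun hv => hlt ?_) hx).symm
    obtain ⟨C, l, r, -, hl, h1, -⟩ := hT.lca_of_isVitalIn hpos ⟨hv, by simp, by simp⟩
    exact ((hT.lca_node (by simp) (by simp) hl).resolve_right fun h => h.1 h1).2.2.lt
  rw [if_pos hlt]
  obtain ⟨c, l, r, hl⟩ : ∃ c l r, T.lca e.1 e.2 = .node c l r := by
    cases h : T.lca e.1 e.2 with
    | leaf S =>
      have := hT.leafIdx_eq_of_lca_leaf (by simp) (by simp) h
      omega
    | node c l r => exact ⟨c, l, r, rfl⟩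
  obtain ⟨h1, h2, hleast⟩ := (hT.lca_node (by simp) (by simp) hl).resolve_right
    fun h => by have := h.2.lt; omega
  rw [rangeMin_treeTables hM hleast]
  obtain ⟨C, hC, rfl, hCl, hCr⟩ := hT.exists_cut_of_lca hl
  rw [add_comm x]
  symm
  refine STGraph.minCutCapacity_setCapacity_eq hpos he hx hC ⟨he, hCl _ h1, hCr _ h2⟩
    (fun hv C' hC' hcon => ?_) ?_ ?_ ?_
  · obtain ⟨D, l', r', hD, hl', -⟩ := hT.lca_of_isVitalIn hpos ⟨hv, by simp, by simp⟩
    rw [hl] at hl'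
    injection hl' with hcap
    rw [hcap]
    exact hD.2.2 C' hC' hcon
  · split_ifs <;> simp
  · rintro C' hC' (h | h)
    · have hsource : e.1 ≠ G.source := fun hs => h (hs ▸ hC'.1)
      rw [if_neg hsource]
      have := (ha _ hsource).2 C' hC' h
      split_ifs <;> simp [this]
    · have hsink : e.2 ≠ G.sink := fun ht => hC'.2 (ht ▸ h)
      rw [if_neg hsink]
      exact (min_le_right _ _).trans ((hb _ hsink).2 C' hC' h)
  · have hfst : (if e.1 = G.source then G.cutCapacity C + x
          else min (G.cutCapacity C + x) (a e.1)) = G.cutCapacity C + x ∨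
        ∃ C', G.IsCut C' ∧ (e.1 ∉ C' ∨ e.2 ∈ C') ∧ (if e.1 = G.source then G.cutCapacity C + x
          else min (G.cutCapacity C + x) (a e.1)) = G.cutCapacity C' := by
      split_ifs with hsource
      · exact .inl rfl
      · obtain ⟨⟨D, hD, hD', hDa⟩, -⟩ := ha _ hsource
        rcases min_choice (G.cutCapacity C + x) (a e.1) with h | h
        · exact .inl h
        · exact .inr ⟨D, hD, .inl hD', h.trans hDa⟩
    split_ifs at hfst ⊢ with hsink hsource hsource
    all_goals first
      | exact hfst
      | (obtain ⟨⟨E, hE, hE', hEb⟩, -⟩ := hb _ ‹_›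
         rcases min_choice _ (b e.2) with h | h
         · rw [h]
           exact hfst
         · exact .inr ⟨E, hE, .inr hE', h.trans hEb⟩)

theorem dims_of_two_le (hn : 2 ≤ n) :
    Dims (10 * (Nat.log 2 n + 1)) n (Nat.log 2 n + 1) (4 * n) := by
  have h1 : n < 2 ^ (Nat.log 2 n + 1) := Nat.lt_pow_succ_log_self (by omega) n
  have h2 : 2 ^ Nat.log 2 n ≤ n := Nat.pow_log_le_self 2 (by omega)
  have h3 : Nat.log 2 n ≤ n := Nat.log_le_self 2 n
  refine ⟨by omega, h1, by rw [pow_succ]; omega, by omega, ?_⟩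
  calc 8 * (4 * n) ≤ 2 ^ 9 * 2 ^ (Nat.log 2 n + 1) := by omega
    _ = 2 ^ (9 + (Nat.log 2 n + 1)) := (pow_add _ _ _).symm
    _ ≤ 2 ^ (10 * (Nat.log 2 n + 1)) := Nat.pow_le_pow_right (by omega) (by omega)

end CapRAM

theorem theorem1p8 :
    ∃ (locate capacity : CapRAM.Program) (wordC spaceC timeC : ℕ), 0 < wordC ∧
    ∀ (n : ℕ) (G : STGraph (Fin n)), (∀ e ∈ G.edges, 0 < G.cap e) →
      -- the tree can be constructed, and whatever choices are made in its construction: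
      (∃ T, IsVitTree G Finset.univ T) ∧
      ∀ T, IsVitTree G Finset.univ T →
        T.numNodes < 2 * n ∧
        -- a vital edge has the capacity of its mincut stored at the LCA of its endpoints
        (∀ e, G.IsVital e → ∃ C c l r, G.IsMinCutFor C e ∧
          T.lca e.1 e.2 = CapTree.node c l r ∧ c = G.cutCapacity C) ∧
        -- vital edges are recognised by position and stored capacity
        (∀ e ∈ G.edges, G.IsVital e ↔ ∃ c l r, T.lca e.1 e.2 = CapTree.node c l r ∧
          e.1 ∈ l.verts ∧ e.2 ∈ r.verts ∧ c - G.cap e < G.minCutCapacity) ∧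
        -- the data structure: linear space, words of logarithmic length, constant query time
        ∃ D : CapRAM.Data, D.size ≤ spaceC * n ∧ D.FitsWords (wordC * (Nat.log 2 n + 1)) ∧
          -- position of two vertices below their LCA, and the capacity stored there
          (∀ u v : Fin n, CapRAM.Answers (wordC * (Nat.log 2 n + 1)) D locate timeC u v 0
            (fun σ =>
              (∀ S, T.lca u v = CapTree.leaf S → σ.wreg 0 = 0) ∧
              (∀ c l r, T.lca u v = CapTree.node c l r →
                σ.wreg 0 = (if u ∈ l.verts then 1 else 2) ∧ σ.rreg 0 = c))) ∧
          -- capacity of the mincut after the change of the capacity of an edge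
          (∀ e ∈ G.edges, ∀ Δ : ℝ, -G.cap e ≤ Δ →
            CapRAM.Answers (wordC * (Nat.log 2 n + 1)) D capacity timeC e.1 e.2 Δ
              (fun σ => σ.rreg 0 = (G.setCapacity e (G.cap e + Δ)).minCutCapacity)) := by
  refine ⟨CapRAM.locate, CapRAM.capacity, 10, 64, 70, by omega, fun n G hpos =>
    ⟨IsVitTree.exists_tree G _, fun T hT => ?_⟩⟩
  have hn : 2 ≤ n := by
    have h1 := G.source.isLt
    have h2 := G.sink.isLt
    have h3 := Fin.val_ne_of_ne G.source_ne_sink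
    omega
  have hnodes : T.numNodes < 2 * n := by
    simpa using hT.numNodes_lt ⟨G.source, Finset.mem_univ _⟩
  refine ⟨hnodes, fun e he => ?_, fun e he => hT.isVital_iff_lca hpos he, ?_⟩
  · obtain ⟨C, l, r, hC, hl, -⟩ := hT.lca_of_isVitalIn hpos ⟨he, by simp, by simp⟩
    exact ⟨C, _, l, r, hC, hl, rfl⟩
  obtain ⟨M, hM⟩ : ∃ M, ∀ i, T.caps.getD i 0 ≤ M := by
    obtain ⟨M, hM⟩ := (insert 0 T.caps.toFinset).exists_le
    refine ⟨M, fun i => hM _ ?_⟩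
    rcases lt_or_ge i T.caps.length with hi | hi
    · rw [List.getD_eq_getElem _ _ hi]
      simp
    · rw [List.getD_eq_default _ _ hi]
      simp
  obtain ⟨a, ha⟩ := G.exists_least_avoiding
  obtain ⟨b, hb⟩ := G.exists_least_hitting
  have hd := CapRAM.dims_of_two_le hn
  have hlt := CapRAM.treeTables_pos_lt (G := G) (M := M) (a := a) (b := b) (by omega) hnodes
  refine ⟨(CapRAM.treeTables G T M a b).data (Nat.log 2 n + 1) (4 * n), ?_,
    CapRAM.Tables.fitsWords_data hd hlt, fun u v => ?_, fun e he x hx => ?_⟩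
  · rw [CapRAM.Tables.size_data]
    omega
  · obtain ⟨hpc, h⟩ := CapRAM.answers_locate hd hM (fun i _ => hlt i) u.isLt v.isLt
    simp only [CapRAM.treeTables_pos] at h
    refine ⟨hpc, fun S hl => ?_, fun c l r hl => ?_⟩
    · have heq := hT.leafIdx_eq_of_lca_leaf (by simp) (by simp) hl
      exact ((h.resolve_right (by omega))).2
    · rcases hT.lca_node (by simp) (by simp) hl with ⟨h1, -, h2⟩ | ⟨h1, h2⟩
      · have := h2.lt
        obtain ⟨-, h3, h4⟩ := (h.resolve_left (by omega)).resolve_right (by omega)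
        exact ⟨by rw [h3, if_pos h1], by rw [h4, CapRAM.rangeMin_treeTables hM h2]⟩
      · have := h2.lt
        obtain ⟨-, h3, h4⟩ := (h.resolve_left (by omega)).resolve_left (by omega)
        exact ⟨by rw [h3, if_neg h1], by rw [h4, CapRAM.rangeMin_treeTables hM h2]⟩
  · obtain ⟨hpc, h⟩ := CapRAM.answers_capacity hd hM (fun i _ => hlt i) x e.1.isLt e.2.isLt
    exact ⟨hpc, h.trans (CapRAM.updated_treeTables hpos hT hM ha hb he hx)⟩
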